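/- Let $S$ be a finite non-empty totally ordered set with maximal element $+$ and minimal element $-$, whose elements are identified with real numbers in an order-preserving way (so that $\int\sigma_0\,d\nu$ makes sense), and let $d$ be a natural number. A probabilistic cellular automaton (PCA) $P$ on $S^{\mathbb Z^d}$ is the Markov chain with transition kernel $P(d\sigma\mid\eta)=\bigotimes_{k\in\mathbb Z^d}p_k(d\sigma_k\mid\eta)$, where $p_k(\cdot\mid\eta)$ is a probability measure on $S$ for each site $k$ and configuration $\eta$. Write $\sigma\preceq\eta$ if $\sigma_k\le\eta_k$ for all $k$. Assume that $P$ is - attractive: $\eta\mapsto\int f\,dP(\cdot\mid\eta)$ is increasing for $\preceq$ whenever $f$ is a (measurable) function increasing for $\preceq$; - translation invariant: $p_k(s\mid\eta)=p_0(s\mid\theta_{-k}\eta)$, where $(\theta_a\eta)_j=\eta_{j-a}$; - non-degenerate: $p_k(s\mid\eta)>0$ for all $k,s,\eta$; - local: for each $k$ there is a finite $V_k\subset\mathbb Z^d$ such that $p_k(\cdot\mid\eta)$ depends only on $(\eta_j)_{j\in V_k}$. Let $B_L=\{k\in\mathbb Z^d:\sum_i|k_i|\le L\}$, and let $\nu_{B_L}^{+}$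 (resp. $\nu_{B_L}^{-}$) be the stationary probability measure of the finite-volume chain on $S^{B_L}$ with transition kernel $\bigotimes_{k\in B_L}p_k(d\sigma_k\mid\eta_{B_L}\tau_{B_L^c})$, where $\tau$ is the configuration equal to $+$ (resp. $-$) at every site. For $f:S^{\mathbb Z^d}\to\mathbb R$ depending on finitely many coordinates ("local"), let $|||f|||=\sum_{k}\sup\{|f(\sigma)-f(\eta)|:\sigma_j=\eta_j\ \forall j\ne k\}$. Then the following are equivalent: (i) there exist $C>0$, $M>0$ and an integer $L_1\ge1$ such that for all integers $L\ge L_1$, $$\int\sigma_0\,d\nu_{B_L}^{+}-\int\sigma_0\,d\nu_{B_L}^{-}\le Ce^{-ML};$$ (ii) $P$ has a unique stationary probability measure $\nu$ on $S^{\mathbb Z^d}$, and there exist $\lambda>0$ and $n_1$ such that for all $n\ge n_1$ and all local functions $f$, $$\sup_{\sigma}\bigl|\delta_\sigma P^{(n)}(f)-\nu(f)\bigr|\le 2\,|||f|||\,e^{-\lambda n}.$$ -/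

import Mathlib

open MeasureTheory ProbabilityTheory

namespace PCA

/-- Configurations: elements of `S^{ℤ^d}`, ordered coordinatewise (`σ ≤ η` iff `σ k ≤ η k` for all
sites `k`) and carrying the product σ-field. -/
abbrev Config (d : ℕ) (S : Type*) : Type _ := (Fin d → ℤ) → S

/-- A probabilistic cellular automaton on `S^{ℤ^d}`, given by its updating rules
`p_k(ds | η)`, one probability kernel from configurations to spins for each site `k`. -/
structure Automaton (d : ℕ) (S : Type*) [MeasurableSpace S] where
  rule : (Fin d → ℤ) → Kernel (Config d S) S
  markov : ∀ k, IsMarkovKernel (rule k)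

attribute [instance] Automaton.markov

/-- A probability measure `ν` with `ν K = ν`. -/
def IsStationary {X : Type*} [MeasurableSpace X] (K : Kernel X X) (ν : Measure X) : Prop :=
  IsProbabilityMeasure ν ∧ ν.bind K = ν

/-- `ν K^(n)`, defined by `ν K^(0) = ν` and `ν K^(n+1) = (ν K^(n)) K`. -/
noncomputable def evolve {X : Type*} [MeasurableSpace X] (K : Kernel X X) (ν : Measure X) :
    ℕ → Measure X
  | 0 => ν
  | n + 1 => (evolve K ν n).bind K

/-- The configuration `η_Λ τ_{Λᶜ}`. -/
def patch {d : ℕ} {S : Type*} (Λ : Finset (Fin d → ℤ)) (η : Λ → S) (τ : Config d S) :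
    Config d S :=
  fun k => if h : k ∈ Λ then η ⟨k, h⟩ else τ k

/-- `θ_a σ = (σ_{k - a})_k`. -/
def shift {d : ℕ} {S : Type*} (a : Fin d → ℤ) (σ : Config d S) : Config d S :=
  fun k => σ (k - a)

namespace Automaton

variable {d : ℕ} {S : Type*} [MeasurableSpace S]

theorem measurable_infinitePi_rule (P : Automaton d S) :
    Measurable fun η : Config d S => Measure.infinitePi fun k => P.rule k η := by
  refine Measurable.measure_of_isPiSystem_of_isProbabilityMeasure
    (generateFrom_squareCylinders (α := fun _ : Fin d → ℤ => S)).symm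
    (isPiSystem_squareCylinders (fun _ => MeasurableSpace.isPiSystem_measurableSet)
      (fun _ => MeasurableSet.univ)) ?_
  rintro _ ⟨s, t, ht, rfl⟩
  have ht' : ∀ i, MeasurableSet (t i) := fun i => ht i (Set.mem_univ i)
  simp only [Measure.infinitePi_pi _ fun i _ => ht' i]
  exact Finset.measurable_prod _ fun i _ => (P.rule i).measurable_coe (ht' i)

/-- The transition kernel `P(dσ | η) = ⨂_{k ∈ ℤ^d} p_k(dσ_k | η)` on `S^{ℤ^d}`. -/
noncomputable def kernel (P : Automaton d S) : Kernel (Config d S) (Config d S) where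
  toFun η := Measure.infinitePi fun k => P.rule k η
  measurable' := P.measurable_infinitePi_rule

/-- The finite volume transition kernel
`P_Λ^τ(dσ_Λ | η_Λ) = ⨂_{k ∈ Λ} p_k(dσ_k | η_Λ τ_{Λᶜ})` on `S^Λ`, with boundary condition `τ`. -/
noncomputable def finiteKernel [Finite S] [DiscreteMeasurableSpace S] (P : Automaton d S)
    (Λ : Finset (Fin d → ℤ)) (τ : Config d S) : Kernel (Λ → S) (Λ → S) where
  toFun η := Measure.pi fun k : Λ => P.rule k (patch Λ η τ)
  measurable' := measurable_of_finite _

/-- `p_k(s | η) > 0` for all `k`, `η`, `s`. -/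
def NonDegenerate (P : Automaton d S) : Prop :=
  ∀ (k : Fin d → ℤ) (η : Config d S) (s : S), 0 < P.rule k η {s}

/-- Each `p_k(· | η)` depends on `η` only through its restriction to a finite set `V_k`. -/
def Local (P : Automaton d S) : Prop :=
  ∀ k : Fin d → ℤ, ∃ V : Finset (Fin d → ℤ), ∀ η η' : Config d S,
    (∀ j ∈ V, η j = η' j) → P.rule k η = P.rule k η'

/-- `p_k(s | η) = p_0(s | θ_{-k} η)`. -/
def TranslationInvariant (P : Automaton d S) : Prop :=
  ∀ (k : Fin d → ℤ) (s : S) (η : Config d S), P.rule k η {s} = P.rule 0 (shift (-k) η) {s}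

/-- `P(f)` is increasing for every increasing (measurable) `f`. When `S` has a least and a greatest
element, an increasing `f` is bounded, so that the integral is the genuine one. -/
def Attractive [LE S] (P : Automaton d S) : Prop :=
  ∀ f : Config d S → ℝ, Measurable f → (∀ σ η, (∀ k, σ k ≤ η k) → f σ ≤ f η) →
    ∀ σ η, (∀ k, σ k ≤ η k) → ∫ ω, f ω ∂(P.kernel σ) ≤ ∫ ω, f ω ∂(P.kernel η)

end Automaton

/-- `f` depends on finitely many coordinates. -/
def IsLocal {d : ℕ} {S : Type*} (f : Config d S → ℝ) : Prop :=
  ∃ Λ : Finset (Fin d → ℤ), ∀ σ η : Config d S, (∀ k ∈ Λ, σ k = η k) → f σ = f η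

/-- `Var_k(f)`: the supremum of `|f σ - f η|` over pairs that agree off the site `k`. -/
noncomputable def variation {d : ℕ} {S : Type*} (k : Fin d → ℤ) (f : Config d S → ℝ) : ℝ :=
  sSup {x | ∃ σ η : Config d S, (∀ j, j ≠ k → σ j = η j) ∧ x = |f σ - f η|}

/-- `|||f||| = ∑_k Var_k(f)` (a finite sum of finite terms when `f` is local and `S` finite). -/
noncomputable def tripleNorm {d : ℕ} {S : Type*} (f : Config d S → ℝ) : ℝ :=
  ∑' k : Fin d → ℤ, variation k f

/-- The ball `B_L = {k ∈ ℤ^d : |k_1| + ⋯ + |k_d| ≤ L}`. -/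
noncomputable def box (d L : ℕ) : Finset (Fin d → ℤ) :=
  (Fintype.piFinset fun _ => Finset.Icc (-(L : ℤ)) L).filter fun k => ∑ i, |k i| ≤ (L : ℤ)

theorem mem_box {d L : ℕ} {k : Fin d → ℤ} : k ∈ box d L ↔ ∑ i, |k i| ≤ (L : ℤ) := by
  simp only [box, Finset.mem_filter, Fintype.mem_piFinset, Finset.mem_Icc, and_iff_right_iff_imp]
  intro h i
  exact abs_le.mp ((Finset.single_le_sum (fun j _ => abs_nonneg (k j)) (Finset.mem_univ i)).trans h)

theorem zero_mem_box (d L : ℕ) : (0 : Fin d → ℤ) ∈ box d L := by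
  simp [mem_box]

end PCA

/-! Everything is governed by one sequence, `gap`: ρ(n) = δ_⊤P^(n)(σ_0) - δ_⊥P^(n)(σ_0), nonnegative
and decreasing by attractiveness. If δ is the least spacing between spin values, a local f is
dominated by spins: ∑ c_k σ_k ± f is increasing for c_k = Var_k(f)/δ. Since P^(n) preserves
monotonicity and, by translation invariance, all sites share the same ρ, the oscillation of P^(n) f
is at most 2|||f|||ρ(n)/δ (`abs_iterate_avg_sub_le`, `abs_iterate_sub_le_of_isLocal`).

(i) ⇒ (ii): ρ is bounded by its finite-volume analogue, which converges because the finite chains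
are positive; so (i) forces ρ → 0. Freezing the spins off B_L after n of 2n steps gives ρ(2n) ≤
c(2L+1)^d ρ(n)² + Ce^{-ML} for every large L (`gap_two_mul_le`). Optimising over L turns this
quadratic recursion into exponential decay (`exp_decay_of_recursion`); a compactness argument
provides ν.

(ii) ⇒ (i): information travels at most r sites per step, so up to time L/r the origin does not see
the boundary of B_L, and the difference of the finite-volume means is at most ρ(⌊L/r⌋)
(`integral_sub_integral_le_gap`). -/

namespace PCA

/-! ### Markov kernels acting on bounded measurable functions. -/

section General

variable {X : Type*} [MeasurableSpace X]

/-- Bounded measurable real functions. -/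
def BddMeas (f : X → ℝ) : Prop := Measurable f ∧ ∃ C, ∀ x, |f x| ≤ C

/-- The action `f ↦ K f` of a kernel on functions. -/
noncomputable def avg (K : Kernel X X) (f : X → ℝ) (x : X) : ℝ := ∫ y, f y ∂(K x)

theorem BddMeas.integrable {f : X → ℝ} (hf : BddMeas f) (μ : Measure X) [IsFiniteMeasure μ] :
    Integrable f μ := by
  obtain ⟨hm, C, hC⟩ := hf
  exact Integrable.of_bound hm.aestronglyMeasurable C (ae_of_all _ hC)

theorem BddMeas.add {f g : X → ℝ} (hf : BddMeas f) (hg : BddMeas g) :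
    BddMeas fun x => f x + g x := by
  obtain ⟨hm, C, hC⟩ := hf
  obtain ⟨hm', C', hC'⟩ := hg
  exact ⟨hm.add hm', C + C', fun x => (abs_add_le _ _).trans (add_le_add (hC x) (hC' x))⟩

theorem BddMeas.const_mul {f : X → ℝ} (hf : BddMeas f) (c : ℝ) : BddMeas fun x => c * f x := by
  obtain ⟨hm, C, hC⟩ := hf
  refine ⟨hm.const_mul c, |c| * C, fun x => ?_⟩
  rw [abs_mul]
  exact mul_le_mul_of_nonneg_left (hC x) (abs_nonneg c)

theorem BddMeas.const (c : ℝ) : BddMeas fun _ : X => c :=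
  ⟨measurable_const, |c|, fun _ => le_rfl⟩

theorem BddMeas.sum {ι : Type*} (s : Finset ι) {f : ι → X → ℝ} (hf : ∀ i, BddMeas (f i)) :
    BddMeas fun x => ∑ i ∈ s, f i x := by
  classical
  induction s using Finset.induction_on with
  | empty => simpa using BddMeas.const 0
  | insert a s ha ih => simpa [Finset.sum_insert ha] using (hf a).add ih

theorem BddMeas.comp {Y : Type*} [MeasurableSpace Y] {f : X → ℝ} (hf : BddMeas f) {g : Y → X}
    (hg : Measurable g) : BddMeas fun y => f (g y) := by
  obtain ⟨hm, C, hC⟩ := hf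
  exact ⟨hm.comp hg, C, fun y => hC _⟩

theorem BddMeas.of_finite [Finite X] [DiscreteMeasurableSpace X] (f : X → ℝ) : BddMeas f := by
  obtain ⟨C, hC⟩ := (Set.finite_range fun x => |f x|).bddAbove
  exact ⟨measurable_of_finite f, C, fun x => hC ⟨x, rfl⟩⟩

variable (K : Kernel X X)

theorem avg_const_mul (c : ℝ) (f : X → ℝ) :
    avg K (fun x => c * f x) = fun x => c * avg K f x :=
  funext fun _ => integral_const_mul _ _

theorem iterate_avg_const_mul (c : ℝ) (f : X → ℝ) (n : ℕ) :
    (avg K)^[n] (fun x => c * f x) = fun x => c * (avg K)^[n] f x := by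
  induction n with
  | zero => rfl
  | succ n ih =>
    simp only [Function.iterate_succ_apply', ih]
    exact avg_const_mul K c _

variable [IsMarkovKernel K]

theorem BddMeas.avg {f : X → ℝ} (hf : BddMeas f) : BddMeas (avg K f) := by
  obtain ⟨C, hC⟩ := hf.2
  refine ⟨(hf.1.stronglyMeasurable.integral_kernel (κ := K)).measurable, C, fun x => ?_⟩
  have := norm_integral_le_of_norm_le_const (μ := K x) (f := f) (C := C) (ae_of_all _ hC)
  simpa [PCA.avg] using this

theorem BddMeas.iterate_avg {f : X → ℝ} (hf : BddMeas f) (n : ℕ) :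
    BddMeas ((PCA.avg K)^[n] f) := by
  induction n with
  | zero => exact hf
  | succ n ih => rw [Function.iterate_succ_apply']; exact ih.avg K

theorem avg_add {f g : X → ℝ} (hf : BddMeas f) (hg : BddMeas g) :
    avg K (fun x => f x + g x) = fun x => avg K f x + avg K g x :=
  funext fun x => integral_add (hf.integrable (K x)) (hg.integrable (K x))

theorem avg_const (c : ℝ) : avg K (fun _ => c) = fun _ => c :=
  funext fun _ => by simp [avg]

theorem avg_mono {f g : X → ℝ} (hf : BddMeas f) (hg : BddMeas g) (h : ∀ x, f x ≤ g x) (x : X) :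
    avg K f x ≤ avg K g x :=
  integral_mono (hf.integrable (K x)) (hg.integrable (K x)) h

theorem iterate_avg_add {f g : X → ℝ} (hf : BddMeas f) (hg : BddMeas g) (n : ℕ) :
    (avg K)^[n] (fun x => f x + g x) = fun x => (avg K)^[n] f x + (avg K)^[n] g x := by
  induction n with
  | zero => rfl
  | succ n ih =>
    simp only [Function.iterate_succ_apply', ih]
    exact avg_add K (hf.iterate_avg K n) (hg.iterate_avg K n)

theorem iterate_avg_const (c : ℝ) (n : ℕ) : (avg K)^[n] (fun _ => c) = fun _ => c :=
  Function.iterate_fixed (avg_const K c) n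

theorem iterate_avg_sum {ι : Type*} (s : Finset ι) {f : ι → X → ℝ} (hf : ∀ i, BddMeas (f i))
    (n : ℕ) :
    (avg K)^[n] (fun x => ∑ i ∈ s, f i x) = fun x => ∑ i ∈ s, (avg K)^[n] (f i) x := by
  classical
  induction s using Finset.induction_on with
  | empty => simpa using iterate_avg_const K 0 n
  | insert a s ha ih =>
    simp only [Finset.sum_insert ha]
    rw [iterate_avg_add K (hf a) (BddMeas.sum s hf), ih]

theorem iterate_avg_mono {f g : X → ℝ} (hf : BddMeas f) (hg : BddMeas g) (h : ∀ x, f x ≤ g x)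
    (n : ℕ) (x : X) : (avg K)^[n] f x ≤ (avg K)^[n] g x := by
  induction n generalizing x with
  | zero => exact h x
  | succ n ih =>
    simp only [Function.iterate_succ_apply']
    exact avg_mono K (hf.iterate_avg K n) (hg.iterate_avg K n) ih x

theorem integral_bind_eq {f : X → ℝ} (hf : BddMeas f) (μ : Measure X) [IsProbabilityMeasure μ] :
    ∫ x, f x ∂(μ.bind K) = ∫ x, avg K f x ∂μ := by
  have := Kernel.integral_comp (κ := Kernel.const Unit μ) (η := K) (a := ()) (f := f)
    (hf.integrable _)
  rwa [Kernel.comp_apply, Kernel.const_apply] at this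

instance isProbabilityMeasure_evolve (μ : Measure X) [IsProbabilityMeasure μ] (n : ℕ) :
    IsProbabilityMeasure (evolve K μ n) := by
  induction n with
  | zero => assumption
  | succ n ih => rw [evolve]; infer_instance

theorem integral_evolve {f : X → ℝ} (hf : BddMeas f) (μ : Measure X) [IsProbabilityMeasure μ]
    (n : ℕ) : ∫ x, f x ∂(evolve K μ n) = ∫ x, (avg K)^[n] f x ∂μ := by
  induction n generalizing f with
  | zero => rfl
  | succ n ih => rw [evolve, integral_bind_eq K hf, ih (hf.avg K), Function.iterate_succ_apply]

theorem integral_evolve_dirac {f : X → ℝ} (hf : BddMeas f) (x : X) (n : ℕ) :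
    ∫ y, f y ∂(evolve K (Measure.dirac x) n) = (avg K)^[n] f x := by
  rw [integral_evolve K hf, integral_dirac' _ _ (hf.iterate_avg K n).1.stronglyMeasurable]

variable {K}

theorem IsStationary.integral_iterate {ν : Measure X} (hν : IsStationary K ν) {f : X → ℝ}
    (hf : BddMeas f) (n : ℕ) : ∫ x, (avg K)^[n] f x ∂ν = ∫ x, f x ∂ν := by
  have := hν.1
  induction n with
  | zero => rfl
  | succ n ih =>
    rw [Function.iterate_succ_apply', ← integral_bind_eq K (hf.iterate_avg K n), hν.2, ih]

theorem le_integral_of_forall_le {μ : Measure X} [IsProbabilityMeasure μ] {f : X → ℝ}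
    (hf : BddMeas f) {c : ℝ} (h : ∀ x, c ≤ f x) : c ≤ ∫ x, f x ∂μ := by
  simpa using integral_mono (integrable_const (μ := μ) c) (hf.integrable μ) h

theorem integral_le_of_forall_le {μ : Measure X} [IsProbabilityMeasure μ] {f : X → ℝ}
    (hf : BddMeas f) {c : ℝ} (h : ∀ x, f x ≤ c) : ∫ x, f x ∂μ ≤ c := by
  simpa using integral_mono (hf.integrable μ) (integrable_const (μ := μ) c) h

end General

/-! ### Convergence of positive finite Markov chains. -/

section Doeblin

variable {X : Type*} [MeasurableSpace X] [Fintype X] [Nonempty X] [DiscreteMeasurableSpace X]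
  {K : Kernel X X} [IsMarkovKernel K]

/-- Every transition gives mass at least ε to a minimiser of `f`, which pulls each average below
`max f` by ε times the oscillation, while no average is below `min f`. -/
theorem avg_sub_avg_le {ε : ℝ} (hε : ∀ x y, ε ≤ (K x).real {y}) {f : X → ℝ} {D : ℝ}
    (hε1 : ε ≤ 1) (hD : ∀ x y, f x - f y ≤ D) (x y : X) :
    avg K f x - avg K f y ≤ (1 - ε) * D := by
  obtain ⟨a, ha⟩ := Finite.exists_min f
  obtain ⟨b, hb⟩ := Finite.exists_max f
  have hf : BddMeas f := BddMeas.of_finite f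
  have h1 : f a ≤ avg K f y := le_integral_of_forall_le hf ha
  have h2 : ε * (f b - f a) ≤ ∫ z, (f b - f z) ∂(K x) := by
    rw [integral_fintype ((BddMeas.of_finite _).integrable _)]
    refine le_trans ?_ (Finset.single_le_sum (f := fun z => (K x).real {z} • (f b - f z))
      (fun z _ => smul_nonneg measureReal_nonneg (sub_nonneg.2 (hb z))) (Finset.mem_univ a))
    exact mul_le_mul_of_nonneg_right (hε x a) (sub_nonneg.2 (hb a))
  rw [integral_sub (integrable_const _) (hf.integrable _)] at h2
  simp only [integral_const, probReal_univ, one_smul] at h2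
  have h3 : (1 - ε) * (f b - f a) ≤ (1 - ε) * D :=
    mul_le_mul_of_nonneg_left (hD b a) (by linarith)
  have h4 : avg K f x = ∫ z, f z ∂(K x) := rfl
  linarith

/-- A finite Markov chain with positive transition probabilities converges to equilibrium. -/
theorem IsStationary.tendsto_iterate {ν : Measure X} (hν : IsStationary K ν)
    (hpos : ∀ x y, 0 < K x {y}) (f : X → ℝ) (x : X) :
    Filter.Tendsto (fun n => (avg K)^[n] f x) Filter.atTop (nhds (∫ y, f y ∂ν)) := by
  have := hν.1
  obtain ⟨p, hp⟩ := Finite.exists_min fun p : X × X => (K p.1).real {p.2}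
  set ε := (K p.1).real {p.2} with hεdef
  have hε0 : 0 < ε := ENNReal.toReal_pos (hpos _ _).ne' (measure_ne_top _ _)
  have hε1 : ε ≤ 1 := measureReal_le_one
  obtain ⟨a, ha⟩ := Finite.exists_min f
  obtain ⟨b, hb⟩ := Finite.exists_max f
  have key : ∀ n x y, (avg K)^[n] f x - (avg K)^[n] f y ≤ (1 - ε) ^ n * (f b - f a) := by
    intro n
    induction n with
    | zero => intro x y; simpa using sub_le_sub (hb x) (ha y)
    | succ n ih =>
      simp only [Function.iterate_succ_apply']
      intro x y
      rw [pow_succ', mul_assoc]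
      exact avg_sub_avg_le (fun x y => hp (x, y)) hε1 ih x y
  have hlim : Filter.Tendsto (fun n : ℕ => (1 - ε) ^ n * (f b - f a)) Filter.atTop (nhds 0) := by
    simpa using (tendsto_pow_atTop_nhds_zero_of_lt_one (by linarith)
      (by linarith : 1 - ε < 1)).mul_const (f b - f a)
  rw [tendsto_iff_dist_tendsto_zero]
  refine squeeze_zero (fun _ => dist_nonneg) (fun n => ?_) hlim
  have hbm : BddMeas ((avg K)^[n] f) := BddMeas.of_finite _
  rw [Real.dist_eq, ← hν.integral_iterate (BddMeas.of_finite f) n, abs_le]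
  constructor
  · linarith [integral_le_of_forall_le (μ := ν) hbm
      (c := (avg K)^[n] f x + (1 - ε) ^ n * (f b - f a)) fun y => by linarith [key n y x]]
  · linarith [le_integral_of_forall_le (μ := ν) hbm
      (c := (avg K)^[n] f x - (1 - ε) ^ n * (f b - f a)) fun y => by linarith [key n x y]]

end Doeblin

end PCA

/-! ### Frozen boundary conditions, locality and monotonicity of the evolution. -/

namespace PCA

variable {d : ℕ} {S : Type*}

theorem patch_apply_mem {Λ : Finset (Fin d → ℤ)} {η : Λ → S} {τ : Config d S} {k : Fin d → ℤ}
    (h : k ∈ Λ) : patch Λ η τ k = η ⟨k, h⟩ := by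
  simp [patch, h]

theorem patch_apply_notMem {Λ : Finset (Fin d → ℤ)} {η : Λ → S} {τ : Config d S}
    {k : Fin d → ℤ} (h : k ∉ Λ) : patch Λ η τ k = τ k := by
  simp [patch, h]

theorem restrict_patch (Λ : Finset (Fin d → ℤ)) (η : Λ → S) (τ : Config d S) :
    Λ.restrict (patch Λ η τ) = η := by
  ext ⟨k, hk⟩
  simp [patch_apply_mem hk]

theorem patch_mono [Preorder S] (Λ : Finset (Fin d → ℤ)) (τ : Config d S) :
    Monotone fun η : Λ → S => patch Λ η τ := by
  intro η η' h k
  by_cases hk : k ∈ Λ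
  · simpa [patch_apply_mem hk] using h ⟨k, hk⟩
  · simp [patch_apply_notMem hk]

theorem le_patch_top [Preorder S] [OrderTop S] (Λ : Finset (Fin d → ℤ)) (σ : Config d S) :
    σ ≤ patch Λ (Λ.restrict σ) (fun _ => ⊤) := by
  intro k
  by_cases hk : k ∈ Λ
  · simp [patch_apply_mem hk]
  · simp [patch_apply_notMem hk]

theorem patch_bot_le [Preorder S] [OrderBot S] (Λ : Finset (Fin d → ℤ)) (σ : Config d S) :
    patch Λ (Λ.restrict σ) (fun _ => ⊥) ≤ σ := by
  intro k
  by_cases hk : k ∈ Λ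
  · simp [patch_apply_mem hk]
  · simp [patch_apply_notMem hk]

theorem bddMeas_restrict [Finite S] [MeasurableSpace S] [DiscreteMeasurableSpace S]
    (Λ : Finset (Fin d → ℤ)) (f : (Λ → S) → ℝ) :
    BddMeas fun σ : Config d S => f (Λ.restrict σ) :=
  (BddMeas.of_finite f).comp (Finset.measurable_restrict Λ)

theorem monotone_comp_restrict [Preorder S] {Λ : Finset (Fin d → ℤ)} {f : (Λ → S) → ℝ}
    (hm : Monotone f) :
    Monotone fun σ : Config d S => f (Λ.restrict σ) := fun _ _ h => hm fun k => h k

theorem bddMeas_of_dependsOn [Finite S] [MeasurableSpace S] [DiscreteMeasurableSpace S]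
    {Λ : Finset (Fin d → ℤ)} {f : Config d S → ℝ} (hf : DependsOn f (Λ : Set (Fin d → ℤ))) :
    BddMeas f := by
  rcases isEmpty_or_nonempty (Config d S) with h | ⟨⟨τ⟩⟩
  · exact ⟨measurable_of_empty f, 0, fun x => (h.false x).elim⟩
  have : f = fun σ => (fun x : Λ → S => f (patch Λ x τ)) (Λ.restrict σ) := by
    funext σ
    exact hf fun k hk => by simp [patch_apply_mem (Finset.mem_coe.1 hk)]
  rw [this]
  exact bddMeas_restrict Λ fun x => f (patch Λ x τ)

/-- The numerical value of the spin at the site `k`. -/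
def spin (v : S → ℝ) (k : Fin d → ℤ) (σ : Config d S) : ℝ := v (σ k)

theorem dependsOn_spin (v : S → ℝ) (k : Fin d → ℤ) :
    DependsOn (spin v k) (({k} : Finset (Fin d → ℤ)) : Set (Fin d → ℤ)) := by
  intro σ η h
  simp [spin, h k (by simp)]

theorem bddMeas_spin [Finite S] [MeasurableSpace S] [DiscreteMeasurableSpace S] (v : S → ℝ)
    (k : Fin d → ℤ) : BddMeas (spin v k : Config d S → ℝ) :=
  bddMeas_of_dependsOn (dependsOn_spin v k)

theorem monotone_spin [Preorder S] {v : S → ℝ} (hv : Monotone v) (k : Fin d → ℤ) :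
    Monotone (spin v k : Config d S → ℝ) := fun _ _ h => hv (h k)

variable [MeasurableSpace S] (P : Automaton d S)

instance isMarkovKernel_kernel : IsMarkovKernel P.kernel :=
  ⟨fun η => inferInstanceAs (IsProbabilityMeasure (Measure.infinitePi fun k => P.rule k η))⟩

instance isMarkovKernel_finiteKernel [Finite S] [DiscreteMeasurableSpace S]
    (Λ : Finset (Fin d → ℤ)) (τ : Config d S) : IsMarkovKernel (P.finiteKernel Λ τ) :=
  ⟨fun η => inferInstanceAs
    (IsProbabilityMeasure (Measure.pi fun k : Λ => P.rule k (patch Λ η τ)))⟩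

theorem avg_kernel_restrict [Finite S] [DiscreteMeasurableSpace S] (Λ : Finset (Fin d → ℤ))
    (f : (Λ → S) → ℝ) (η : Config d S) :
    avg P.kernel (fun σ => f (Λ.restrict σ)) η = ∫ x, f x ∂(Measure.pi fun k : Λ => P.rule k η) :=
  integral_restrict_infinitePi (μ := fun k => P.rule k η)
    (measurable_of_finite f).aestronglyMeasurable

/-- This identity lets attractiveness, assumed in infinite volume only, pass to the finite chains.
-/
theorem avg_finiteKernel [Finite S] [DiscreteMeasurableSpace S] (Λ : Finset (Fin d → ℤ))
    (τ : Config d S) (f : (Λ → S) → ℝ) (η : Λ → S) :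
    avg (P.finiteKernel Λ τ) f η = avg P.kernel (fun σ => f (Λ.restrict σ)) (patch Λ η τ) :=
  (avg_kernel_restrict P Λ f _).symm

/-- The `Λ`-marginal of the product measure involves only the rules at sites of `Λ`. -/
theorem avg_kernel_congr [Finite S] [DiscreteMeasurableSpace S] {Λ : Finset (Fin d → ℤ)}
    {f : Config d S → ℝ} (hf : DependsOn f (Λ : Set (Fin d → ℤ))) {η η' : Config d S}
    (h : ∀ k ∈ Λ, P.rule k η = P.rule k η') : avg P.kernel f η = avg P.kernel f η' := by
  have hfe : f = fun σ => (fun x : Λ → S => f (patch Λ x η)) (Λ.restrict σ) := by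
    funext σ
    exact hf fun k hk => by simp [patch_apply_mem (Finset.mem_coe.1 hk)]
  rw [hfe, avg_kernel_restrict P Λ (fun x => f (patch Λ x η)),
    avg_kernel_restrict P Λ (fun x => f (patch Λ x η))]
  congr 2
  funext k
  exact h k k.2

variable {P}

theorem finiteKernel_singleton_pos [Finite S] [DiscreteMeasurableSpace S]
    (hnd : P.NonDegenerate) (Λ : Finset (Fin d → ℤ)) (τ : Config d S) (x y : Λ → S) :
    0 < P.finiteKernel Λ τ x {y} := by
  have : P.finiteKernel Λ τ x {y} = ∏ k : Λ, P.rule k (patch Λ x τ) {y k} :=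
    Measure.pi_singleton (fun k : Λ => P.rule k (patch Λ x τ)) y
  rw [this]
  exact pos_iff_ne_zero.2 (Finset.prod_ne_zero_iff.2 fun k _ => (hnd _ _ _).ne')

theorem isLocal_avg [Finite S] [DiscreteMeasurableSpace S] (hl : P.Local) {f : Config d S → ℝ}
    (hf : IsLocal f) : IsLocal (avg P.kernel f) := by
  classical
  obtain ⟨Λ, hΛ⟩ := hf
  choose V hV using hl
  exact ⟨Λ.biUnion V, fun η η' h => avg_kernel_congr P (Λ := Λ) (fun σ σ' hσ => hΛ σ σ' hσ)
    fun k hk => hV k η η' fun j hj => h j (Finset.mem_biUnion.2 ⟨k, hk, hj⟩)⟩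

theorem monotone_avg [Preorder S] (ha : P.Attractive) {f : Config d S → ℝ} (hf : BddMeas f)
    (hm : Monotone f) : Monotone (avg P.kernel f) :=
  fun σ η h => ha f hf.1 (fun _ _ h => hm h) σ η h

theorem monotone_iterate_avg [Preorder S] (ha : P.Attractive) {f : Config d S → ℝ} (hf : BddMeas f)
    (hm : Monotone f) (n : ℕ) : Monotone ((avg P.kernel)^[n] f) := by
  induction n with
  | zero => exact hm
  | succ n ih =>
    rw [Function.iterate_succ_apply']
    exact monotone_avg ha (hf.iterate_avg _ n) ih

theorem monotone_iterate_avg_finite [Preorder S] [Finite S] [DiscreteMeasurableSpace S]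
    (ha : P.Attractive) {Λ : Finset (Fin d → ℤ)}
    (τ : Config d S) {f : (Λ → S) → ℝ} (hm : Monotone f) (n : ℕ) :
    Monotone ((avg (P.finiteKernel Λ τ))^[n] f) := by
  induction n with
  | zero => exact hm
  | succ n ih =>
    rw [Function.iterate_succ_apply']
    intro x y h
    rw [avg_finiteKernel, avg_finiteKernel]
    exact monotone_avg ha (bddMeas_restrict Λ _) (monotone_comp_restrict ih) (patch_mono Λ τ h)

/-! ### Translation invariance of the evolution. -/

section Shift

theorem rule_eq_rule_zero [Finite S] [DiscreteMeasurableSpace S] (ht : P.TranslationInvariant)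
    (k : Fin d → ℤ) (η : Config d S) : P.rule k η = P.rule 0 (shift (-k) η) :=
  Measure.ext_of_singleton fun s => ht k s η

theorem avg_kernel_shift [Finite S] [DiscreteMeasurableSpace S] (ht : P.TranslationInvariant)
    {f : Config d S → ℝ} (hf : BddMeas f) (a : Fin d → ℤ) (η : Config d S) :
    avg P.kernel f (shift a η) = avg P.kernel (fun σ => f (shift a σ)) η := by
  have hmeas : Measurable (shift a : Config d S → Config d S) :=
    measurable_pi_lambda _ fun k => measurable_pi_apply _
  have hmap : (P.kernel η).map (shift a) = P.kernel (shift a η) := by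
    have h := Measure.map_infinitePi_infinitePi_of_inj (P := fun k => P.rule k η)
      (f := fun k : Fin d → ℤ => k - a) (sub_left_injective)
    refine Eq.trans h ?_
    change _ = Measure.infinitePi fun k => P.rule k (shift a η)
    congr 1
    funext k
    rw [rule_eq_rule_zero ht k, rule_eq_rule_zero ht (k - a)]
    congr 1
    funext j
    simp only [shift]
    congr 1
    abel
  rw [avg, ← hmap, integral_map hmeas.aemeasurable hf.1.aestronglyMeasurable]
  rfl

theorem iterate_avg_kernel_shift [Finite S] [DiscreteMeasurableSpace S]
    (ht : P.TranslationInvariant) {f : Config d S → ℝ} (hf : BddMeas f) (a : Fin d → ℤ) (n : ℕ)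
    (η : Config d S) :
    (avg P.kernel)^[n] f (shift a η) = (avg P.kernel)^[n] (fun σ => f (shift a σ)) η := by
  induction n generalizing η with
  | zero => rfl
  | succ n ih =>
    rw [Function.iterate_succ_apply', Function.iterate_succ_apply',
      avg_kernel_shift ht (hf.iterate_avg _ n)]
    simp only [ih]

/-- Constant configurations are fixed by shifts; this is why the gap at the origin controls every
site. -/
theorem iterate_avg_spin_const [Finite S] [DiscreteMeasurableSpace S]
    (ht : P.TranslationInvariant) (v : S → ℝ) (k : Fin d → ℤ) (n : ℕ) (s : S) :
    (avg P.kernel)^[n] (spin v k) (fun _ => s) = (avg P.kernel)^[n] (spin v 0) (fun _ => s) := by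
  have h := iterate_avg_kernel_shift ht (bddMeas_spin v 0) (-k) n (fun _ => s)
  have e : (fun σ : Config d S => spin v 0 (shift (-k) σ)) = spin v k := by
    funext σ
    simp [spin, shift]
  rw [e] at h
  exact h.symm

end Shift

/-! ### Stochastic domination and the gap sequence. -/

section Attractive

variable [LinearOrder S] [BoundedOrder S] [Finite S] [DiscreteMeasurableSpace S]

/-- The chain with maximal boundary condition dominates the infinite volume one. -/
theorem iterate_avg_le_finite (ha : P.Attractive) {Λ : Finset (Fin d → ℤ)}
    {f : (Λ → S) → ℝ} (hm : Monotone f) {g : Config d S → ℝ} (hg : BddMeas g)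
    (hgf : ∀ σ, g σ ≤ f (Λ.restrict σ)) (n : ℕ) (σ : Config d S) :
    (avg P.kernel)^[n] g σ ≤ (avg (P.finiteKernel Λ fun _ => ⊤))^[n] f (Λ.restrict σ) := by
  induction n generalizing σ with
  | zero => exact hgf σ
  | succ n ih =>
    rw [Function.iterate_succ_apply', Function.iterate_succ_apply', avg_finiteKernel]
    exact (avg_mono _ (hg.iterate_avg _ n) (bddMeas_restrict Λ _) ih σ).trans
      (monotone_avg ha (bddMeas_restrict Λ _)
        (monotone_comp_restrict (monotone_iterate_avg_finite ha _ hm n)) (le_patch_top Λ σ))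

/-- The chain with minimal boundary condition is dominated by the infinite volume one. -/
theorem finite_le_iterate_avg (ha : P.Attractive) {Λ : Finset (Fin d → ℤ)}
    {f : (Λ → S) → ℝ} (hm : Monotone f) {g : Config d S → ℝ} (hg : BddMeas g)
    (hgf : ∀ σ, f (Λ.restrict σ) ≤ g σ) (n : ℕ) (σ : Config d S) :
    (avg (P.finiteKernel Λ fun _ => ⊥))^[n] f (Λ.restrict σ) ≤ (avg P.kernel)^[n] g σ := by
  induction n generalizing σ with
  | zero => exact hgf σ
  | succ n ih =>
    rw [Function.iterate_succ_apply', Function.iterate_succ_apply', avg_finiteKernel]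
    exact (monotone_avg ha (bddMeas_restrict Λ _)
        (monotone_comp_restrict (monotone_iterate_avg_finite ha _ hm n)) (patch_bot_le Λ σ)).trans
      (avg_mono _ (bddMeas_restrict Λ _) (hg.iterate_avg _ n) ih σ)

/-- `ρ(n) = δ_⊤ P^(n)(σ_0) - δ_⊥ P^(n)(σ_0)`. -/
noncomputable def gap (P : Automaton d S) (v : S → ℝ) (n : ℕ) : ℝ :=
  (avg P.kernel)^[n] (spin v 0) (fun _ => ⊤) - (avg P.kernel)^[n] (spin v 0) (fun _ => ⊥)

theorem gap_nonneg (ha : P.Attractive) {v : S → ℝ} (hv : Monotone v) (n : ℕ) : 0 ≤ gap P v n :=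
  sub_nonneg.2 (monotone_iterate_avg ha (bddMeas_spin v 0) (monotone_spin hv 0) n
    fun _ => bot_le)

/-- One more step from `⊤` replaces the maximum of an increasing function by an average of its
values, and dually from `⊥`. -/
theorem antitone_gap (ha : P.Attractive) {v : S → ℝ} (hv : Monotone v) :
    Antitone (gap P v) := by
  refine antitone_nat_of_succ_le fun n => ?_
  have hm := monotone_iterate_avg ha (bddMeas_spin v 0) (monotone_spin hv 0) n
  have hb : BddMeas _ := (bddMeas_spin v 0).iterate_avg P.kernel n
  simp only [gap, Function.iterate_succ_apply']
  refine sub_le_sub ?_ ?_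
  · exact integral_le_of_forall_le hb fun σ => hm fun _ => le_top
  · exact le_integral_of_forall_le hb fun σ => hm fun _ => bot_le

/-- Functions whose increments along ordered pairs are controlled by those of the spins
inherit the control along the evolution. -/
theorem abs_iterate_avg_sub_le (ha : P.Attractive) (ht : P.TranslationInvariant) {v : S → ℝ}
    (hv : Monotone v) {f : Config d S → ℝ} (hf : BddMeas f) {Λ : Finset (Fin d → ℤ)}
    {c : (Fin d → ℤ) → ℝ} (hc : ∀ k, 0 ≤ c k)
    (h : ∀ σ η : Config d S, σ ≤ η → |f η - f σ| ≤ ∑ k ∈ Λ, c k * (v (η k) - v (σ k)))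
    (n : ℕ) {σ η : Config d S} (hση : σ ≤ η) :
    |(avg P.kernel)^[n] f η - (avg P.kernel)^[n] f σ| ≤ (∑ k ∈ Λ, c k) * gap P v n := by
  have hs : ∀ k, BddMeas fun σ : Config d S => c k * spin v k σ := fun k =>
    (bddMeas_spin v k).const_mul (c k)
  -- The sign `e` yields both halves of the absolute value.
  have main : ∀ e : ℝ, |e| = 1 →
      e * ((avg P.kernel)^[n] f η - (avg P.kernel)^[n] f σ) ≤ (∑ k ∈ Λ, c k) * gap P v n := by
    intro e he
    -- The domination hypothesis says exactly that the spin sum outgrows `e * f`; applying the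
    -- evolution to this increasing function gives the bound.
    have hmono : Monotone fun σ : Config d S => (∑ k ∈ Λ, c k * spin v k σ) + (-e) * f σ := by
      intro σ η hση
      have h1 := h σ η hση
      have h2 : e * (f η - f σ) ≤ |f η - f σ| := by
        have := le_abs_self (e * (f η - f σ))
        rwa [abs_mul, he, one_mul] at this
      have h3 : ∑ k ∈ Λ, c k * (v (η k) - v (σ k))
          = ∑ k ∈ Λ, c k * spin v k η - ∑ k ∈ Λ, c k * spin v k σ := by
        rw [← Finset.sum_sub_distrib]
        exact Finset.sum_congr rfl fun k _ => mul_sub _ _ _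
      simp only
      linarith
    have h1 := monotone_iterate_avg ha ((BddMeas.sum Λ hs).add (hf.const_mul (-e))) hmono n hση
    rw [iterate_avg_add _ (BddMeas.sum Λ hs) (hf.const_mul (-e)), iterate_avg_sum _ Λ hs,
      iterate_avg_const_mul] at h1
    simp only [iterate_avg_const_mul] at h1
    have h2 : ∀ k, (avg P.kernel)^[n] (spin v k) η - (avg P.kernel)^[n] (spin v k) σ
        ≤ gap P v n := by
      intro k
      have hm := monotone_iterate_avg ha (bddMeas_spin v k) (monotone_spin hv k) n
      rw [gap, ← iterate_avg_spin_const ht v k, ← iterate_avg_spin_const ht v k]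
      exact sub_le_sub (hm fun _ => le_top) (hm fun _ => bot_le)
    have h3 : ∑ k ∈ Λ, c k * (avg P.kernel)^[n] (spin v k) η
        - ∑ k ∈ Λ, c k * (avg P.kernel)^[n] (spin v k) σ ≤ (∑ k ∈ Λ, c k) * gap P v n := by
      rw [← Finset.sum_sub_distrib, Finset.sum_mul]
      refine Finset.sum_le_sum fun k _ => ?_
      rw [← mul_sub]
      exact mul_le_mul_of_nonneg_left (h2 k) (hc k)
    linarith
  refine abs_le.2 ⟨?_, ?_⟩
  · linarith [main (-1) (by simp)]
  · linarith [main 1 (by simp)]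

end Attractive

end PCA

namespace PCA

/-! ### Exponential decay from the quadratic recursion. -/

section Recursion

open Filter Topology Real

/-- Taking L of order (2/M) log(1/ρ(n)) makes the exponential term at most Cρ(n)², at the price of a
factor log(1/ρ(n))^d, which is negligible against 1/ρ(n) as ρ → 0. -/
theorem eventually_two_mul_le_mul {ρ : ℕ → ℝ} (h0 : ∀ n, 0 ≤ ρ n)
    (hanti : Antitone ρ) (hlim : Tendsto ρ atTop (𝓝 0)) {d : ℕ} {c C M : ℝ} (hc : 0 ≤ c)
    (hC : 0 ≤ C) (hM : 0 < M) {L₁ : ℕ}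
    (hrec : ∀ n L : ℕ, L₁ ≤ L →
      ρ (2 * n) ≤ c * (2 * L + 1) ^ d * ρ n ^ 2 + C * exp (-(M * L)))
    {ε : ℝ} (hε : 0 < ε) : ∀ᶠ n in atTop, ρ (2 * n) ≤ ε * ρ n := by
  -- Chosen so that `2 * L + 1 ≤ a * y` for the `L` below and `y ≥ 1`.
  set a : ℝ := 4 / M + (2 * L₁ + 3) with ha
  have ha0 : 0 ≤ a := by positivity
  have hlim1 : Tendsto (fun y : ℝ => c * a ^ d * (y ^ d * exp (-y)) + C * (y ^ 0 * exp (-y)))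
      atTop (𝓝 0) := by
    simpa using ((tendsto_pow_mul_exp_neg_atTop_nhds_zero d).const_mul (c * a ^ d)).add
      ((tendsto_pow_mul_exp_neg_atTop_nhds_zero 0).const_mul C)
  obtain ⟨Y, hY⟩ := ((hlim1.eventually (ge_mem_nhds hε)).and (eventually_ge_atTop 1))
    |>.exists_forall_of_atTop
  filter_upwards [hlim.eventually (gt_mem_nhds (exp_pos (-Y)))] with n hn
  -- If `ρ n = 0` the logarithm is useless, but `ρ` then stays zero.
  rcases (h0 n).eq_or_lt with hz | hp
  · rw [← hz, mul_zero, hz]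
    exact hanti (by omega)
  set x := ρ n with hx
  set y := -log x with hy
  have hxy : x = exp (-y) := by rw [hy, neg_neg, exp_log hp]
  have hYy : Y ≤ y := by
    have := (log_lt_iff_lt_exp hp).2 hn
    linarith
  obtain ⟨hY1, hy1⟩ := hY y hYy
  set L : ℕ := ⌈2 * y / M⌉₊ + L₁ with hL
  have hL1 : 2 * y / M ≤ L := by
    rw [hL]; push_cast
    linarith [Nat.le_ceil (2 * y / M), (Nat.cast_nonneg L₁ : (0 : ℝ) ≤ L₁)]
  have hL2 : (2 * L + 1 : ℝ) ≤ a * y := by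
    have := Nat.ceil_lt_add_one (a := 2 * y / M) (by positivity)
    have h2 : (L : ℝ) ≤ 2 * y / M + 1 + L₁ := by rw [hL]; push_cast; linarith
    have h3 : a * y = 2 * (2 * y / M) + (2 * L₁ + 3) * y := by rw [ha]; ring
    have h4 : (2 * L₁ + 3 : ℝ) * 1 ≤ (2 * L₁ + 3) * y :=
      mul_le_mul_of_nonneg_left hy1 (by positivity)
    linarith
  have hexp : exp (-(M * L)) ≤ x ^ 2 := by
    rw [hxy, ← exp_nat_mul]
    refine exp_le_exp.2 ?_
    have := (div_le_iff₀ hM).1 hL1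
    push_cast
    linarith
  have hpow : (2 * L + 1 : ℝ) ^ d ≤ a ^ d * y ^ d := by
    rw [← mul_pow]
    exact pow_le_pow_left₀ (by positivity) hL2 d
  calc ρ (2 * n) ≤ c * (2 * L + 1) ^ d * x ^ 2 + C * exp (-(M * L)) := hrec n L (by omega)
    _ ≤ c * (a ^ d * y ^ d) * x ^ 2 + C * x ^ 2 := by gcongr
    _ = (c * a ^ d * (y ^ d * exp (-y)) + C * (y ^ 0 * exp (-y))) * x := by rw [← hxy]; ring
    _ ≤ ε * x := mul_le_mul_of_nonneg_right hY1 hp.le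

/-- With L = n, the corrected quantity `h` satisfies h(2n) ≤ h(n)² for large n. The previous lemma
makes `h` fall to 1/2 along dyadic times; from there repeated squaring gives 2^{-2^k} at time 2^k
n₀. -/
theorem exp_decay_of_recursion {ρ : ℕ → ℝ} (h0 : ∀ n, 0 ≤ ρ n)
    (hanti : Antitone ρ) (hlim : Tendsto ρ atTop (𝓝 0)) {d : ℕ} {c C M : ℝ} (hc : 0 ≤ c)
    (hC : 0 ≤ C) (hM : 0 < M) {L₁ : ℕ}
    (hrec : ∀ n L : ℕ, L₁ ≤ L →
      ρ (2 * n) ≤ c * (2 * L + 1) ^ d * ρ n ^ 2 + C * exp (-(M * L))) :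
    ∃ lam : ℝ, 0 < lam ∧ ∀ᶠ n : ℕ in atTop, ρ n ≤ exp (-(lam * n)) := by
  -- With M = 4m, the error n^d e^{-Mn} is eventually below a multiple of e^{-2mn}. Two such terms
  -- 2e^{-2mn}, one from this error and one from `h (2 * n)`, add up to (2e^{-mn})².
  set m := M / 4 with hm
  have hm0 : 0 < m := by positivity
  set A : ℝ := 6 ^ d * c + 1 with hA
  have hA1 : 1 ≤ A := by
    rw [hA]
    linarith [mul_nonneg (pow_nonneg (by norm_num : (0 : ℝ) ≤ 6) d) hc]
  set h : ℕ → ℝ := fun n => A * n ^ d * ρ n + 2 * exp (-(m * n)) with hh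
  have hh0 : ∀ n, 0 ≤ h n := fun n => by
    have := h0 n
    simp only [hh]; positivity
  -- the quantity `h` is squared when the time is doubled
  have hsq : ∀ᶠ n : ℕ in atTop, h (2 * n) ≤ h n ^ 2 := by
    have hl : Tendsto (fun n : ℕ => A * 2 ^ d * C / (2 * m) ^ d *
        ((2 * m * (n : ℝ)) ^ d * exp (-(2 * m * n)))) atTop (𝓝 0) := by
      have := (tendsto_pow_mul_exp_neg_atTop_nhds_zero d).comp
        ((tendsto_natCast_atTop_atTop (R := ℝ)).const_mul_atTop (by positivity : 0 < 2 * m))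
      simpa using this.const_mul (A * 2 ^ d * C / (2 * m) ^ d)
    filter_upwards [hl.eventually (ge_mem_nhds (by norm_num : (0 : ℝ) < 2)), eventually_ge_atTop L₁,
      eventually_ge_atTop 1] with n hn hnL hn1
    have hn1' : (1 : ℝ) ≤ n := by exact_mod_cast hn1
    have hρ := h0 n
    have hn' : A * 2 ^ d * C * (n : ℝ) ^ d * exp (-(2 * m * n)) ≤ 2 := by
      refine le_trans (le_of_eq ?_) hn
      rw [mul_pow (2 * m) (n : ℝ) d]
      field_simp
    have h1 : ρ (2 * n) ≤ c * (3 ^ d * n ^ d) * ρ n ^ 2 + C * exp (-(M * n)) := by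
      refine (hrec n n hnL).trans ?_
      have : (2 * n + 1 : ℝ) ^ d ≤ 3 ^ d * n ^ d := by
        rw [← mul_pow]
        exact pow_le_pow_left₀ (by positivity) (by linarith) d
      gcongr
    have e1 : exp (-(M * n)) = exp (-(2 * m * n)) * exp (-(2 * m * n)) := by
      rw [← exp_add]; congr 1; rw [hm]; ring
    have e2 : exp (-(2 * m * n)) = exp (-(m * n)) * exp (-(m * n)) := by
      rw [← exp_add]; congr 1; ring
    have e3 : exp (-(m * ((2 * n : ℕ) : ℝ))) = exp (-(2 * m * n)) := by
      congr 1; push_cast; ring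
    set E := exp (-(2 * m * n)) with hE
    have hE0 : 0 < E := exp_pos _
    have h2 : A * (2 * n : ℝ) ^ d * ρ (2 * n) ≤
        A * (6 ^ d * c) * ((n : ℝ) ^ d * ρ n) ^ 2 + 2 * E := by
      calc A * (2 * n : ℝ) ^ d * ρ (2 * n)
          ≤ A * (2 * n : ℝ) ^ d * (c * (3 ^ d * n ^ d) * ρ n ^ 2 + C * exp (-(M * n))) := by
            gcongr
        _ = A * ((2 * 3) ^ d * c) * ((n : ℝ) ^ d * ρ n) ^ 2
            + (A * 2 ^ d * C * (n : ℝ) ^ d * E) * E := by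
            rw [e1, mul_pow, mul_pow]; ring
        _ ≤ A * (6 ^ d * c) * ((n : ℝ) ^ d * ρ n) ^ 2 + 2 * E := by
            norm_num only
            gcongr
    have h3 : A * (6 ^ d * c) * ((n : ℝ) ^ d * ρ n) ^ 2 ≤ A * A * ((n : ℝ) ^ d * ρ n) ^ 2 := by
      gcongr
      linarith
    have h4 : 0 ≤ A * n ^ d * ρ n * exp (-(m * n)) := by positivity
    simp only [hh]
    rw [e3]
    push_cast
    nlinarith [h2, h3, h4, e2]
  -- The factor (1/2)^d offsets the growth of n^d under doubling, and the extra 1/2 makes n^d ρ(n)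
  -- tend to zero.
  obtain ⟨N, hN⟩ := ((hsq.and ((eventually_two_mul_le_mul h0 hanti hlim hc hC hM hrec
    (by positivity : (0 : ℝ) < (1 / 2) ^ d * (1 / 2))).and
      (eventually_ge_atTop 1)))).exists_forall_of_atTop
  have hN1 : 1 ≤ N := (hN N le_rfl).2.2
  have hge : ∀ k, N ≤ 2 ^ k * N := fun k => Nat.le_mul_of_pos_left N (by positivity)
  -- along dyadic times `h` tends to zero
  have hdy : ∀ k : ℕ, ρ (2 ^ k * N) ≤ ((1 / 2) ^ d * (1 / 2)) ^ k * ρ N := by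
    intro k
    induction k with
    | zero => simp
    | succ k ih =>
      have := (hN (2 ^ k * N) (hge k)).2.1
      rw [show 2 ^ (k + 1) * N = 2 * (2 ^ k * N) by ring, pow_succ', mul_assoc]
      exact this.trans (mul_le_mul_of_nonneg_left ih (by positivity))
  have hbound : ∀ k : ℕ, h (2 ^ k * N) ≤ A * N ^ d * ρ N * (1 / 2) ^ k
      + 2 * exp (-(m * ((2 ^ k * N : ℕ) : ℝ))) := by
    intro k
    have hid : ((2 : ℝ) ^ k) ^ d * ((1 / 2) ^ d) ^ k = 1 := by
      rw [← pow_mul, ← pow_mul, mul_comm d k, ← mul_pow]; norm_num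
    refine add_le_add_left ?_ _
    calc A * ((2 ^ k * N : ℕ) : ℝ) ^ d * ρ (2 ^ k * N)
        ≤ A * ((2 ^ k * N : ℕ) : ℝ) ^ d * (((1 / 2) ^ d * (1 / 2)) ^ k * ρ N) := by
          gcongr; exact hdy k
      _ = A * N ^ d * ρ N * (1 / 2) ^ k * (((2 : ℝ) ^ k) ^ d * ((1 / 2) ^ d) ^ k) := by
          push_cast; rw [mul_pow, mul_pow]; ring
      _ = A * N ^ d * ρ N * (1 / 2) ^ k := by rw [hid, mul_one]
  have hpowlim : Tendsto (fun k : ℕ => 2 ^ k * N) atTop atTop :=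
    tendsto_atTop_mono (fun k => (Nat.lt_two_pow_self (n := k)).le.trans
      (Nat.le_mul_of_pos_right _ hN1)) tendsto_id
  have hlimh : Tendsto (fun k : ℕ => A * N ^ d * ρ N * (1 / 2 : ℝ) ^ k
      + 2 * exp (-(m * ((2 ^ k * N : ℕ) : ℝ)))) atTop (𝓝 0) := by
    have t1 := (tendsto_pow_atTop_nhds_zero_of_lt_one (by norm_num : (0 : ℝ) ≤ 1 / 2)
      (by norm_num)).const_mul (A * N ^ d * ρ N)
    have t2 := (tendsto_exp_neg_atTop_nhds_zero.comp
      (((tendsto_natCast_atTop_atTop (R := ℝ)).comp hpowlim).const_mul_atTop hm0)).const_mul 2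
    simpa using t1.add t2
  obtain ⟨k₀, hk₀⟩ := (hlimh.eventually (ge_mem_nhds (by norm_num : (0 : ℝ) < 1 / 2))).exists
  set n₀ := 2 ^ k₀ * N with hn₀
  have hn₀1 : 1 ≤ n₀ := hN1.trans (hge k₀)
  have hhk : ∀ k : ℕ, h (2 ^ k * n₀) ≤ (1 / 2) ^ (2 ^ k) := by
    intro k
    induction k with
    | zero => simpa using (hbound k₀).trans hk₀
    | succ k ih =>
      have hge' : N ≤ 2 ^ k * n₀ := (hge k₀).trans (Nat.le_mul_of_pos_left _ (by positivity))
      rw [show 2 ^ (k + 1) * n₀ = 2 * (2 ^ k * n₀) by ring, pow_succ 2 k, pow_mul]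
      exact (hN _ hge').1.trans (pow_le_pow_left₀ (hh0 _) ih 2)
  have hρh : ∀ n, 1 ≤ n → ρ n ≤ h n := by
    intro n hn
    have hn' : (1 : ℝ) ≤ n := by exact_mod_cast hn
    have h1 : 1 ≤ A * (n : ℝ) ^ d := one_le_mul_of_one_le_of_one_le hA1 (one_le_pow₀ hn')
    have h2 := le_mul_of_one_le_left (h0 n) h1
    have h3 := exp_pos (-(m * n))
    simp only [hh]
    linarith
  -- A general n lies between 2^k n₀ and 2^(k+1) n₀; rounding down costs the 2 in the denominator.
  refine ⟨log 2 / (2 * n₀), by have := log_pos one_lt_two; positivity, ?_⟩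
  filter_upwards [eventually_ge_atTop n₀] with n hn
  have hq : n / n₀ ≠ 0 := (Nat.div_pos hn hn₀1).ne'
  set k := Nat.log 2 (n / n₀) with hk
  have hk1 : 2 ^ k * n₀ ≤ n :=
    (Nat.le_div_iff_mul_le hn₀1).1 (Nat.pow_log_le_self 2 hq)
  have hk2 : n < 2 ^ (k + 1) * n₀ :=
    (Nat.div_lt_iff_lt_mul hn₀1).1 (Nat.lt_pow_succ_log_self one_lt_two _)
  have hk3 : (n : ℝ) ≤ 2 ^ k * (2 * n₀) := by
    have : (n : ℝ) ≤ ((2 ^ (k + 1) * n₀ : ℕ) : ℝ) := by exact_mod_cast hk2.le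
    refine this.trans (le_of_eq ?_)
    push_cast; ring
  calc ρ n ≤ ρ (2 ^ k * n₀) := hanti hk1
    _ ≤ h (2 ^ k * n₀) := hρh _ (hn₀1.trans (Nat.le_mul_of_pos_left _ (by positivity)))
    _ ≤ (1 / 2) ^ (2 ^ k) := hhk k
    _ = exp (-(log 2 * 2 ^ k)) := by
      rw [one_div, ← exp_log (by norm_num : (0 : ℝ) < 2), ← exp_neg, ← exp_nat_mul]
      congr 1
      simp [exp_log]
      ring
    _ ≤ exp (-(log 2 / (2 * n₀) * n)) := by
      refine exp_le_exp.2 (neg_le_neg ?_)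
      have hn₀' : (0 : ℝ) < 2 * n₀ := by
        have : (1 : ℝ) ≤ n₀ := by exact_mod_cast hn₀1
        linarith
      rw [div_mul_eq_mul_div, div_le_iff₀ hn₀', mul_assoc]
      exact mul_le_mul_of_nonneg_left hk3 (log_pos one_lt_two).le

end Recursion

end PCA

namespace PCA

/-! ### Comparison with the finite-volume stationary measures. -/

section Comparison

open Filter Topology

theorem monotone_eval {d : ℕ} {S : Type*} [Preorder S] {v : S → ℝ} {Λ : Finset (Fin d → ℤ)}
    (h0 : 0 ∈ Λ) (hv : Monotone v) : Monotone fun x : Λ → S => v (x ⟨0, h0⟩) :=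
  fun _ _ h => hv (h _)

/-- The least spacing of the values converts a change of spin into a numerical increment. The value
1 serves when there is no strict pair. -/
theorem exists_pos_le_sub {S : Type*} [Finite S] [Preorder S] {v : S → ℝ} (hv : StrictMono v) :
    ∃ δ : ℝ, 0 < δ ∧ ∀ s t, s < t → δ ≤ v t - v s := by
  rcases isEmpty_or_nonempty {p : S × S // p.1 < p.2} with he | hne
  · exact ⟨1, one_pos, fun s t h => (he.false ⟨(s, t), h⟩).elim⟩
  · obtain ⟨p, hp⟩ := Finite.exists_min fun p : {p : S × S // p.1 < p.2} => v p.1.2 - v p.1.1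
    exact ⟨_, sub_pos.2 (hv p.2), fun s t h => hp ⟨(s, t), h⟩⟩

variable {d : ℕ} {S : Type*} [MeasurableSpace S] [Finite S] [LinearOrder S] [BoundedOrder S]
  [DiscreteMeasurableSpace S] {P : Automaton d S}

variable {v : S → ℝ} {Λ : Finset (Fin d → ℤ)} (h0 : 0 ∈ Λ) {νmax νmin : Measure (Λ → S)}

theorem gap_le_finite (ha : P.Attractive) (hv : Monotone v) (n : ℕ) :
    gap P v n ≤ (avg (P.finiteKernel Λ fun _ => ⊤))^[n] (fun x => v (x ⟨0, h0⟩)) (fun _ => ⊤)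
      - (avg (P.finiteKernel Λ fun _ => ⊥))^[n] (fun x => v (x ⟨0, h0⟩)) (fun _ => ⊥) :=
  sub_le_sub
    (iterate_avg_le_finite ha (monotone_eval h0 hv) (bddMeas_spin v 0) (fun _ => le_rfl) n
      fun _ => ⊤)
    (finite_le_iterate_avg ha (monotone_eval h0 hv) (bddMeas_spin v 0) (fun _ => le_rfl) n
      fun _ => ⊥)

/-- The finite-volume upper bound on the gap converges to the difference of the stationary means, by
positivity of the chains. -/
theorem eventually_gap_lt (ha : P.Attractive) (hnd : P.NonDegenerate) (hv : Monotone v)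
    (hmax : IsStationary (P.finiteKernel Λ fun _ => ⊤) νmax)
    (hmin : IsStationary (P.finiteKernel Λ fun _ => ⊥) νmin) {ε : ℝ}
    (hε : (∫ x, v (x ⟨0, h0⟩) ∂νmax) - (∫ x, v (x ⟨0, h0⟩) ∂νmin) < ε) :
    ∀ᶠ n in atTop, gap P v n < ε := by
  have := Fintype.ofFinite S
  have t := (hmax.tendsto_iterate (finiteKernel_singleton_pos hnd Λ _)
      (fun x => v (x ⟨0, h0⟩)) (fun _ => ⊤)).sub
    (hmin.tendsto_iterate (finiteKernel_singleton_pos hnd Λ _)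
      (fun x => v (x ⟨0, h0⟩)) (fun _ => ⊥))
  filter_upwards [t.eventually (gt_mem_nhds hε)] with n hn
  exact (gap_le_finite h0 ha hv n).trans_lt hn

/-- With a frozen configuration off `Λ`, the increments of `P^(n)(σ_0)` are controlled by those
of the spins in `Λ`. -/
theorem abs_iterate_patch_sub_le (ha : P.Attractive) (hv : Monotone v) {δ : ℝ} (hδ : 0 < δ)
    (hvδ : ∀ s t, s < t → δ ≤ v t - v s) (τ : Config d S) (n : ℕ) {σ η : Config d S}
    (h : σ ≤ η) :
    |(avg P.kernel)^[n] (spin v 0) (patch Λ (Λ.restrict η) τ)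
        - (avg P.kernel)^[n] (spin v 0) (patch Λ (Λ.restrict σ) τ)|
      ≤ ∑ k ∈ Λ, gap P v n / δ * (v (η k) - v (σ k)) := by
  have hg := gap_nonneg ha hv n
  have hm := monotone_iterate_avg ha (bddMeas_spin v 0) (monotone_spin hv 0) n
  have hnn : ∀ k ∈ Λ, 0 ≤ gap P v n / δ * (v (η k) - v (σ k)) := fun k _ =>
    mul_nonneg (div_nonneg hg hδ.le) (sub_nonneg.2 (hv (h k)))
  by_cases hne : ∃ k ∈ Λ, σ k ≠ η k
  · obtain ⟨k, hk, hk'⟩ := hne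
    have h1 : δ ≤ v (η k) - v (σ k) := hvδ _ _ (lt_of_le_of_ne (h k) hk')
    have h2 : gap P v n ≤ gap P v n / δ * (v (η k) - v (σ k)) := by
      rw [div_mul_eq_mul_div, le_div_iff₀ hδ]
      exact mul_le_mul_of_nonneg_left h1 hg
    refine le_trans ?_ (h2.trans (Finset.single_le_sum hnn hk))
    have hp : patch Λ (Λ.restrict σ) τ ≤ patch Λ (Λ.restrict η) τ :=
      patch_mono Λ τ fun k => h k
    rw [abs_of_nonneg (sub_nonneg.2 (hm hp))]
    exact sub_le_sub (hm fun _ => le_top) (hm fun _ => bot_le)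
  · push Not at hne
    have : Λ.restrict σ = Λ.restrict η := funext fun k => hne k k.2
    rw [this, sub_self, abs_zero]
    exact Finset.sum_nonneg hnn

/-- At the intermediate time the spins off `Λ` are raised to `⊤` (function `A`) or lowered to `⊥`
(function `B`). Exchanging the two initial conditions in `A` and in `B` costs |Λ|ρ(n)²/δ each; after
the exchange, the finite-volume means bound them. -/
theorem gap_two_mul_le (ha : P.Attractive) (ht : P.TranslationInvariant) (hv : Monotone v)
    {δ : ℝ} (hδ : 0 < δ) (hvδ : ∀ s t, s < t → δ ≤ v t - v s)
    (hmax : IsStationary (P.finiteKernel Λ fun _ => ⊤) νmax)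
    (hmin : IsStationary (P.finiteKernel Λ fun _ => ⊥) νmin) (n : ℕ) :
    gap P v (2 * n) ≤ 2 * (Λ.card / δ) * gap P v n ^ 2
      + ((∫ x, v (x ⟨0, h0⟩) ∂νmax) - (∫ x, v (x ⟨0, h0⟩) ∂νmin)) := by
  have := hmax.1
  have := hmin.1
  set f₀ : (Λ → S) → ℝ := fun x => v (x ⟨0, h0⟩) with hf₀
  have hf₀m : Monotone f₀ := monotone_eval h0 hv
  set F := (avg P.kernel)^[n] (spin v 0) with hF
  have hFb : BddMeas F := (bddMeas_spin v 0).iterate_avg _ n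
  have hFm : Monotone F := monotone_iterate_avg ha (bddMeas_spin v 0) (monotone_spin hv 0) n
  set A : Config d S → ℝ := fun σ => F (patch Λ (Λ.restrict σ) fun _ => ⊤) with hA
  set B : Config d S → ℝ := fun σ => F (patch Λ (Λ.restrict σ) fun _ => ⊥) with hB
  have hAb : BddMeas A := bddMeas_restrict Λ fun x => F (patch Λ x fun _ => ⊤)
  have hBb : BddMeas B := bddMeas_restrict Λ fun x => F (patch Λ x fun _ => ⊥)
  have hg : 0 ≤ gap P v n / δ := div_nonneg (gap_nonneg ha hv n) hδ.le
  have hsum : (∑ _k ∈ Λ, gap P v n / δ) * gap P v n = Λ.card / δ * gap P v n ^ 2 := by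
    rw [Finset.sum_const, nsmul_eq_mul]; ring
  have hA1 := abs_iterate_avg_sub_le ha ht hv hAb (Λ := Λ) (fun _ => hg)
    (fun σ η h => abs_iterate_patch_sub_le ha hv hδ hvδ (fun _ => ⊤) n h) n
    (σ := fun _ => ⊥) (η := fun _ => ⊤) fun _ => bot_le
  have hB1 := abs_iterate_avg_sub_le ha ht hv hBb (Λ := Λ) (fun _ => hg)
    (fun σ η h => abs_iterate_patch_sub_le ha hv hδ hvδ (fun _ => ⊥) n h) n
    (σ := fun _ => ⊥) (η := fun _ => ⊤) fun _ => bot_le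
  rw [hsum] at hA1 hB1
  -- `A` lies below n steps of the maximal-boundary chain, so this is below 2n steps of that chain
  -- from `⊥`, hence below its stationary mean.
  have hA2 : (avg P.kernel)^[n] A (fun _ => ⊥) ≤ ∫ x, f₀ x ∂νmax := by
    have hm' := monotone_iterate_avg_finite ha (fun _ => ⊤) hf₀m n
    have h1 : ∀ σ, A σ ≤ (avg (P.finiteKernel Λ fun _ => ⊤))^[n] f₀ (Λ.restrict σ) := by
      intro σ
      have := iterate_avg_le_finite ha hf₀m (bddMeas_spin v 0) (fun _ => le_rfl) n
        (patch Λ (Λ.restrict σ) fun _ => ⊤)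
      rwa [restrict_patch] at this
    refine (iterate_avg_le_finite ha hm' hAb h1 n _).trans ?_
    rw [← hmax.integral_iterate (BddMeas.of_finite f₀) n,
      ← hmax.integral_iterate (BddMeas.of_finite _) n]
    exact le_integral_of_forall_le (BddMeas.of_finite _) fun x =>
      monotone_iterate_avg_finite ha _ hm' n fun _ => bot_le
  have hB2 : ∫ x, f₀ x ∂νmin ≤ (avg P.kernel)^[n] B (fun _ => ⊤) := by
    have hm' := monotone_iterate_avg_finite ha (fun _ => ⊥) hf₀m n
    have h1 : ∀ σ, (avg (P.finiteKernel Λ fun _ => ⊥))^[n] f₀ (Λ.restrict σ) ≤ B σ := by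
      intro σ
      have := finite_le_iterate_avg ha hf₀m (bddMeas_spin v 0) (fun _ => le_rfl) n
        (patch Λ (Λ.restrict σ) fun _ => ⊥)
      rwa [restrict_patch] at this
    refine le_trans ?_ (finite_le_iterate_avg ha hm' hBb h1 n _)
    rw [← hmin.integral_iterate (BddMeas.of_finite f₀) n,
      ← hmin.integral_iterate (BddMeas.of_finite _) n]
    exact integral_le_of_forall_le (BddMeas.of_finite _) fun x =>
      monotone_iterate_avg_finite ha _ hm' n fun _ => le_top
  have hA3 : (avg P.kernel)^[n] F (fun _ => ⊤) ≤ (avg P.kernel)^[n] A (fun _ => ⊤) :=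
    iterate_avg_mono _ hFb hAb (fun σ => hFm (le_patch_top Λ σ)) n _
  have hB3 : (avg P.kernel)^[n] B (fun _ => ⊥) ≤ (avg P.kernel)^[n] F (fun _ => ⊥) :=
    iterate_avg_mono _ hBb hFb (fun σ => hFm (patch_bot_le Λ σ)) n _
  have hgap : gap P v (2 * n)
      = (avg P.kernel)^[n] F (fun _ => ⊤) - (avg P.kernel)^[n] F (fun _ => ⊥) := by
    rw [gap, two_mul, Function.iterate_add_apply]
  have := (abs_le.1 hA1).2
  have := (abs_le.1 hB1).2
  rw [hgap]
  linarith

theorem card_box_le (d L : ℕ) : (box d L).card ≤ (2 * L + 1) ^ d := by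
  refine (Finset.card_filter_le _ _).trans ?_
  rw [Fintype.card_piFinset]
  simp only [Int.card_Icc, Finset.prod_const, Finset.card_univ, Fintype.card_fin]
  apply le_of_eq
  congr 1
  omega

end Comparison

end PCA

namespace PCA

/-! ### Local functions: variations, separation of measures, compactness. -/

section LocalFunctions

open Filter Topology

variable {d : ℕ} {S : Type*}

theorem variation_nonneg (k : Fin d → ℤ) (f : Config d S → ℝ) : 0 ≤ variation k f :=
  Real.sSup_nonneg fun x => by rintro ⟨σ, η, -, rfl⟩; exact abs_nonneg _

theorem tripleNorm_nonneg (f : Config d S → ℝ) : 0 ≤ tripleNorm f :=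
  tsum_nonneg fun k => variation_nonneg k f

theorem abs_sub_le_variation [Finite S] [MeasurableSpace S] [DiscreteMeasurableSpace S]
    {f : Config d S → ℝ} (hf : IsLocal f) {k : Fin d → ℤ}
    {σ η : Config d S} (h : ∀ j, j ≠ k → σ j = η j) : |f σ - f η| ≤ variation k f := by
  obtain ⟨Λ, hΛ⟩ := hf
  obtain ⟨C, hC⟩ := (bddMeas_of_dependsOn (Λ := Λ) (f := f) fun σ η h => hΛ σ η h).2
  refine le_csSup ⟨C + C, ?_⟩ ⟨σ, η, h, rfl⟩
  rintro x ⟨σ, η, -, rfl⟩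
  exact (abs_sub _ _).trans (add_le_add (hC σ) (hC η))

theorem tripleNorm_eq_sum {f : Config d S → ℝ} {Λ : Finset (Fin d → ℤ)}
    (hΛ : ∀ σ η : Config d S, (∀ k ∈ Λ, σ k = η k) → f σ = f η) :
    tripleNorm f = ∑ k ∈ Λ, variation k f := by
  refine tsum_eq_sum fun k hk => le_antisymm (Real.sSup_le ?_ le_rfl) (variation_nonneg k f)
  rintro x ⟨σ, η, h, rfl⟩
  rw [hΛ σ η fun j hj => h j fun e => hk (e ▸ hj), sub_self, abs_zero]

theorem abs_sub_le_sum_variation [LinearOrder S] [Finite S] [MeasurableSpace S]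
    [DiscreteMeasurableSpace S] {v : S → ℝ} {δ : ℝ} (hδ : 0 < δ)
    (hvδ : ∀ s t, s < t → δ ≤ v t - v s) {f : Config d S → ℝ} {Λ : Finset (Fin d → ℤ)}
    (hΛ : ∀ σ η : Config d S, (∀ k ∈ Λ, σ k = η k) → f σ = f η) {σ η : Config d S}
    (h : σ ≤ η) : |f η - f σ| ≤ ∑ k ∈ Λ, variation k f / δ * (v (η k) - v (σ k)) := by
  classical
  -- Telescoping: `σ` is turned into `η` one site at a time.
  have key : ∀ s : Finset (Fin d → ℤ), |f (s.piecewise η σ) - f σ|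
      ≤ ∑ k ∈ s, variation k f / δ * (v (η k) - v (σ k)) := by
    intro s
    induction s using Finset.induction_on with
    | empty => simp
    | insert a s ha ih =>
      rw [Finset.sum_insert ha]
      refine (abs_sub_le _ (f (s.piecewise η σ)) _).trans (add_le_add ?_ ih)
      rw [Finset.piecewise_insert]
      by_cases hne : σ a = η a
      · have : Function.update (s.piecewise η σ) a (η a) = s.piecewise η σ := by
          rw [Function.update_eq_self_iff, Finset.piecewise_eq_of_notMem _ _ _ ha, hne]
        rw [this, hne, sub_self, sub_self, abs_zero, mul_zero]
      · have h1 : δ ≤ v (η a) - v (σ a) := hvδ _ _ (lt_of_le_of_ne (h a) hne)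
        refine (abs_sub_le_variation ⟨Λ, hΛ⟩ (k := a) fun j hj => ?_).trans ?_
        · rw [Function.update_of_ne hj]
        · rw [div_mul_eq_mul_div, le_div_iff₀ hδ]
          exact mul_le_mul_of_nonneg_left h1 (variation_nonneg a f)
  have := key Λ
  rwa [hΛ (Λ.piecewise η σ) η fun k hk => Finset.piecewise_eq_of_mem _ _ _ hk] at this

/-- Indicators of measurable cylinders are local, and cylinders form a generating π-system. -/
theorem ext_of_local [MeasurableSpace S] {μ ν : Measure (Config d S)} [IsProbabilityMeasure μ]
    [IsProbabilityMeasure ν]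
    (h : ∀ f : Config d S → ℝ, IsLocal f → ∫ σ, f σ ∂μ = ∫ σ, f σ ∂ν) : μ = ν := by
  have hcyl := isPiSystem_measurableCylinders (α := fun _ : Fin d → ℤ => S)
  refine ext_of_generate_finite _
    (generateFrom_measurableCylinders (α := fun _ : Fin d → ℤ => S)).symm hcyl
    (fun A hA => ?_) (by simp)
  obtain ⟨s, B, hB, rfl⟩ := (mem_measurableCylinders A).1 hA
  have hm : MeasurableSet (cylinder (α := fun _ => S) s B) := MeasurableSet.cylinder s hB
  have := h ((cylinder s B).indicator 1) ⟨s, fun σ η hση => by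
    have hr : s.restrict σ = s.restrict η := funext fun k => hση k k.2
    have hiff : σ ∈ cylinder s B ↔ η ∈ cylinder s B := by
      change s.restrict σ ∈ B ↔ s.restrict η ∈ B
      rw [hr]
    classical
    exact if_congr hiff rfl rfl⟩
  rw [integral_indicator_one hm, integral_indicator_one hm] at this
  exact (measureReal_eq_measureReal_iff).1 this

variable [MeasurableSpace S] [Finite S] [DiscreteMeasurableSpace S]

theorem IsLocal.bddMeas {f : Config d S → ℝ} (hf : IsLocal f) : BddMeas f := by
  obtain ⟨Λ, hΛ⟩ := hf
  exact bddMeas_of_dependsOn (Λ := Λ) fun σ η h => hΛ σ η h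

/-- A weak limit point along a sequence of probability measures, tested on local functions. -/
theorem exists_local_limit (μ : ℕ → Measure (Config d S)) [∀ n, IsProbabilityMeasure (μ n)] :
    ∃ (U : Filter ℕ) (ν : Measure (Config d S)), U.NeBot ∧ U ≤ atTop ∧ IsProbabilityMeasure ν ∧
      ∀ f : Config d S → ℝ, IsLocal f →
        Tendsto (fun n => ∫ σ, f σ ∂(μ n)) U (𝓝 (∫ σ, f σ ∂ν)) := by
  -- With the discrete topology on the finite `S`, configurations form a compact space, hence so do
  -- their probability measures, and local functions are continuous.
  let : TopologicalSpace S := ⊥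
  have : DiscreteTopology S := ⟨rfl⟩
  have : BorelSpace S := ⟨by
    rw [borel_eq_top_of_discrete]
    exact le_antisymm le_top fun s _ => MeasurableSet.of_discrete⟩
  let p : ℕ → ProbabilityMeasure (Config d S) := fun n => ⟨μ n, inferInstance⟩
  let V : Ultrafilter (ProbabilityMeasure (Config d S)) := (Ultrafilter.of (atTop : Filter ℕ)).map p
  obtain ⟨ν, -, hν⟩ := (isCompact_univ (X := ProbabilityMeasure (Config d S))).ultrafilter_le_nhds V
    (by simp)
  refine ⟨(Ultrafilter.of (atTop : Filter ℕ) : Filter ℕ), ν, inferInstance,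
    Ultrafilter.of_le _, inferInstance, fun f hf => ?_⟩
  have hb := hf.bddMeas
  obtain ⟨Λ, hΛ⟩ := hf
  have hc : Continuous f := by
    refine continuous_iff_continuousAt.2 fun σ => ?_
    have hopen : ∀ᶠ η in 𝓝 σ, ∀ k ∈ Λ, η k = σ k :=
      (Finset.eventually_all Λ).2 fun k _ =>
        (continuous_apply k).continuousAt.eventually
          ((isOpen_discrete {σ k}).mem_nhds rfl)
    exact tendsto_nhds_of_eventually_eq (hopen.mono fun η h => hΛ η σ h)
  exact (ProbabilityMeasure.tendsto_iff_forall_integral_tendsto (μs := p)).1 hν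
    (BoundedContinuousFunction.mkOfCompact ⟨f, hc⟩)

end LocalFunctions

end PCA

namespace PCA

open Filter Topology

/-! ### Existence, uniqueness and exponential decay of the gap. -/

section Ergodicity

variable {d : ℕ} {S : Type*} [MeasurableSpace S] [Finite S] [LinearOrder S] [BoundedOrder S]
  [DiscreteMeasurableSpace S] {P : Automaton d S} {v : S → ℝ} {δ : ℝ}

/-- The gap bound needs ordered pairs, so both configurations are compared with `⊥`; hence the
factor 2. -/
theorem abs_iterate_sub_le_of_isLocal (ha : P.Attractive) (ht : P.TranslationInvariant)
    (hv : Monotone v) (hδ : 0 < δ) (hvδ : ∀ s t, s < t → δ ≤ v t - v s)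
    {f : Config d S → ℝ} (hf : IsLocal f) (n : ℕ) (σ η : Config d S) :
    |(avg P.kernel)^[n] f σ - (avg P.kernel)^[n] f η| ≤ 2 * tripleNorm f * (gap P v n / δ) := by
  have hb := hf.bddMeas
  obtain ⟨Λ, hΛ⟩ := hf
  have key : ∀ σ : Config d S, |(avg P.kernel)^[n] f σ - (avg P.kernel)^[n] f (fun _ => ⊥)|
      ≤ tripleNorm f * (gap P v n / δ) := by
    intro σ
    have := abs_iterate_avg_sub_le ha ht hv hb (Λ := Λ)
      (fun k => div_nonneg (variation_nonneg k f) hδ.le)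
      (fun σ η h => abs_sub_le_sum_variation hδ hvδ hΛ h) n
      (σ := fun _ => ⊥) (η := σ) fun _ => bot_le
    rwa [← Finset.sum_div, ← tripleNorm_eq_sum hΛ, div_mul_eq_mul_div, mul_div_assoc] at this
  have h1 := abs_le.1 (key σ)
  have h2 := abs_le.1 (key η)
  exact abs_le.2 ⟨by linarith, by linarith⟩

theorem abs_iterate_sub_integral_le (ha : P.Attractive) (ht : P.TranslationInvariant)
    (hv : Monotone v) (hδ : 0 < δ) (hvδ : ∀ s t, s < t → δ ≤ v t - v s)
    {f : Config d S → ℝ} (hf : IsLocal f) (n : ℕ) (σ : Config d S) (μ : Measure (Config d S))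
    [IsProbabilityMeasure μ] :
    |(avg P.kernel)^[n] f σ - ∫ η, (avg P.kernel)^[n] f η ∂μ|
      ≤ 2 * tripleNorm f * (gap P v n / δ) := by
  have key := fun η => abs_le.1 (abs_iterate_sub_le_of_isLocal ha ht hv hδ hvδ hf n σ η)
  have hb : BddMeas _ := hf.bddMeas.iterate_avg P.kernel n
  have h1 := le_integral_of_forall_le (μ := μ) hb
    (c := (avg P.kernel)^[n] f σ - 2 * tripleNorm f * (gap P v n / δ))
    fun η => by linarith [(key η).2]
  have h2 := integral_le_of_forall_le (μ := μ) hb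
    (c := (avg P.kernel)^[n] f σ + 2 * tripleNorm f * (gap P v n / δ))
    fun η => by linarith [(key η).1]
  exact abs_le.2 ⟨by linarith, by linarith⟩

/-- A limit point of δ_⊤P^(n) is stationary because P^(n) f and P^(n+1) f merge at `⊤`. It is unique
because P^(n) f(⊤) converges to the mean of `f` under any stationary measure. -/
theorem exists_unique_stationary (ha : P.Attractive) (ht : P.TranslationInvariant)
    (hl : P.Local) (hv : Monotone v) (hδ : 0 < δ) (hvδ : ∀ s t, s < t → δ ≤ v t - v s)
    (hlim : Tendsto (gap P v) atTop (𝓝 0)) :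
    ∃ ν, IsStationary P.kernel ν ∧ ∀ ν', IsStationary P.kernel ν' → ν' = ν := by
  have hbd : ∀ f : Config d S → ℝ,
      Tendsto (fun n => 2 * tripleNorm f * (gap P v n / δ)) atTop (𝓝 0) := fun f => by
    simpa using (hlim.div_const δ).const_mul (2 * tripleNorm f)
  obtain ⟨U, ν, hU, hUle, hν, hconv⟩ :=
    exists_local_limit fun n => evolve P.kernel (Measure.dirac fun _ => ⊤) n
  have hconv' : ∀ f : Config d S → ℝ, IsLocal f →
      Tendsto (fun n => (avg P.kernel)^[n] f fun _ => ⊤) U (𝓝 (∫ σ, f σ ∂ν)) := fun f hf => by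
    simpa only [integral_evolve_dirac P.kernel hf.bddMeas] using hconv f hf
  have hstat : IsStationary P.kernel ν := by
    refine ⟨hν, ext_of_local fun f hf => ?_⟩
    rw [integral_bind_eq P.kernel hf.bddMeas]
    have h1 := (hconv' f hf).sub (hconv' _ (isLocal_avg hl hf))
    have h2 : Tendsto (fun n => (avg P.kernel)^[n] f (fun _ => ⊤)
        - (avg P.kernel)^[n] (avg P.kernel f) fun _ => ⊤) U (𝓝 0) := by
      refine squeeze_zero_norm (fun n => ?_) ((hbd f).mono_left hUle)
      -- The (n+1)-st iterate at `⊤` is read as the mean of the n-th under P(· | ⊤).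
      rw [← Function.iterate_succ_apply, Function.iterate_succ_apply', Real.norm_eq_abs]
      exact abs_iterate_sub_integral_le ha ht hv hδ hvδ hf n _ (P.kernel fun _ => ⊤)
    exact (sub_eq_zero.1 (tendsto_nhds_unique h1 h2)).symm
  refine ⟨ν, hstat, fun ν' hν' => ?_⟩
  have := hν'.1
  refine ext_of_local fun f hf => ?_
  have hto : ∀ μ, IsStationary P.kernel μ →
      Tendsto (fun n => (avg P.kernel)^[n] f fun _ => ⊤) atTop (𝓝 (∫ σ, f σ ∂μ)) := by
    intro μ hμ
    have := hμ.1
    rw [tendsto_iff_norm_sub_tendsto_zero]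
    refine squeeze_zero (fun _ => norm_nonneg _) (fun n => ?_) (hbd f)
    rw [Real.norm_eq_abs, ← hμ.integral_iterate hf.bddMeas n]
    exact abs_iterate_sub_integral_le ha ht hv hδ hvδ hf n _ μ
  exact tendsto_nhds_unique (hto ν' hν') (hto ν hstat)

variable {νmax νmin : ∀ L : ℕ, Measure (box d L → S)}

theorem exp_decay_gap (ha : P.Attractive) (ht : P.TranslationInvariant) (hnd : P.NonDegenerate)
    (hv : Monotone v) (hδ : 0 < δ) (hvδ : ∀ s t, s < t → δ ≤ v t - v s)
    (hmax : ∀ L, IsStationary (P.finiteKernel (box d L) fun _ => ⊤) (νmax L))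
    (hmin : ∀ L, IsStationary (P.finiteKernel (box d L) fun _ => ⊥) (νmin L))
    {C M : ℝ} (hC : 0 < C) (hM : 0 < M) {L₁ : ℕ}
    (h : ∀ L : ℕ, L₁ ≤ L → (∫ σ, v (σ ⟨0, zero_mem_box d L⟩) ∂(νmax L))
        - (∫ σ, v (σ ⟨0, zero_mem_box d L⟩) ∂(νmin L)) ≤ C * Real.exp (-(M * L))) :
    Tendsto (gap P v) atTop (𝓝 0) ∧
      ∃ lam : ℝ, 0 < lam ∧ ∀ᶠ n : ℕ in atTop, gap P v n ≤ Real.exp (-(lam * n)) := by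
  have hlim : Tendsto (gap P v) atTop (𝓝 0) := by
    refine tendsto_order.2 ⟨fun a ha' => Eventually.of_forall fun n =>
      ha'.trans_le (gap_nonneg ha hv n), fun ε hε => ?_⟩
    have t : Tendsto (fun L : ℕ => C * Real.exp (-(M * L))) atTop (𝓝 0) := by
      simpa using (Real.tendsto_exp_neg_atTop_nhds_zero.comp
        ((tendsto_natCast_atTop_atTop (R := ℝ)).const_mul_atTop hM)).const_mul C
    obtain ⟨L, hL, hL₁⟩ := ((t.eventually (gt_mem_nhds hε)).and (eventually_ge_atTop L₁)).exists
    exact eventually_gap_lt (zero_mem_box d L) ha hnd hv (hmax L) (hmin L) ((h L hL₁).trans_lt hL)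
  refine ⟨hlim, exp_decay_of_recursion (c := 2 / δ) (d := d) (L₁ := L₁) (gap_nonneg ha hv)
    (antitone_gap ha hv) hlim (by positivity) hC.le hM fun n L hL => ?_⟩
  refine (gap_two_mul_le (zero_mem_box d L) ha ht hv hδ hvδ (hmax L) (hmin L) n).trans
    (add_le_add ?_ (h L hL))
  have hcard : ((box d L).card : ℝ) ≤ (2 * L + 1) ^ d := by exact_mod_cast card_box_le d L
  refine mul_le_mul_of_nonneg_right ?_ (sq_nonneg _)
  rw [div_mul_eq_mul_div, mul_div_assoc]
  gcongr

end Ergodicity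

/-! ### Finite range and finite speed of propagation. -/

section FiniteRange

variable {d : ℕ} {S : Type*} [MeasurableSpace S] [Finite S] [DiscreteMeasurableSpace S]
  {P : Automaton d S}

/-- Each `p_k(· | η)` depends on `η` only through its restriction to the ball `k + B_r`. -/
def Automaton.HasRange {S : Type*} [MeasurableSpace S] (P : Automaton d S) (r : ℕ) : Prop :=
  ∀ (k : Fin d → ℤ) (η η' : Config d S),
    (∀ j, ∑ i, |j i - k i| ≤ (r : ℤ) → η j = η' j) → P.rule k η = P.rule k η'

theorem exists_hasRange (ht : P.TranslationInvariant) (hl : P.Local) :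
    ∃ r : ℕ, 0 < r ∧ P.HasRange r := by
  obtain ⟨V, hV⟩ := hl 0
  -- The `+ 1` keeps the range positive, since `L` is later divided by it.
  refine ⟨V.sup (fun j => (∑ i, |j i|).toNat) + 1, Nat.succ_pos _, fun k η η' h => ?_⟩
  rw [rule_eq_rule_zero ht k η, rule_eq_rule_zero ht k η']
  refine hV _ _ fun j hj => h _ ?_
  have h1 : (∑ i, |j i|).toNat ≤ V.sup (fun j => (∑ i, |j i|).toNat) :=
    Finset.le_sup (f := fun j : Fin d → ℤ => (∑ i, |j i|).toNat) hj
  simp only [Pi.sub_apply, Pi.neg_apply, sub_neg_eq_add, add_sub_cancel_right]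
  omega

theorem box_mono {L L' : ℕ} (h : L ≤ L') : box d L ⊆ box d L' := fun k hk =>
  mem_box.2 ((mem_box.1 hk).trans (by exact_mod_cast h))

variable {r : ℕ}

theorem dependsOn_iterate_avg (hr : P.HasRange r) (v : S → ℝ) (n : ℕ) :
    DependsOn ((avg P.kernel)^[n] (spin v 0)) (box d (r * n) : Set (Fin d → ℤ)) := by
  induction n with
  | zero => exact (dependsOn_spin v 0).mono (by simp [zero_mem_box])
  | succ n ih =>
    rw [Function.iterate_succ_apply']
    intro η η' h
    refine avg_kernel_congr P ih fun k hk => hr k η η' fun j hj => h j ?_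
    refine Finset.mem_coe.2 (mem_box.2 ?_)
    have h1 := mem_box.1 hk
    calc ∑ i, |j i| ≤ ∑ i, (|j i - k i| + |k i|) :=
          Finset.sum_le_sum fun i _ => by simpa using abs_add_le (j i - k i) (k i)
      _ = ∑ i, |j i - k i| + ∑ i, |k i| := Finset.sum_add_distrib
      _ ≤ ((r * (n + 1) : ℕ) : ℤ) := by push_cast at h1 ⊢; linarith

/-- Finite speed of propagation. -/
theorem iterate_avg_eq_finite (hr : P.HasRange r) (v : S → ℝ) (τ : Config d S) {L n : ℕ}
    (hn : r * n ≤ L) (x : box d L → S) :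
    (avg (P.finiteKernel (box d L) τ))^[n] (fun x => v (x ⟨0, zero_mem_box d L⟩)) x
      = (avg P.kernel)^[n] (spin v 0) (patch (box d L) x τ) := by
  induction n generalizing x with
  | zero => simp [spin, patch_apply_mem (zero_mem_box d L)]
  | succ n ih =>
    have hn' : r * n ≤ L := (Nat.mul_le_mul_left r n.le_succ).trans hn
    rw [Function.iterate_succ_apply', Function.iterate_succ_apply', avg_finiteKernel]
    congr 1
    funext σ
    rw [ih hn']
    exact dependsOn_iterate_avg hr v n fun k hk => by
      simp [patch_apply_mem (box_mono hn' (Finset.mem_coe.1 hk))]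

/-- Stationarity bounds the maximal-boundary mean by n steps of the finite chain from `⊤`, which
coincide with the infinite-volume evolution while `r * n ≤ L`; dually for `⊥`. -/
theorem integral_sub_integral_le_gap [LinearOrder S] [BoundedOrder S]
    (hr : P.HasRange r) (ha : P.Attractive) {v : S → ℝ} (hv : Monotone v) {L n : ℕ}
    (hn : r * n ≤ L) {νmax νmin : Measure (box d L → S)}
    (hmax : IsStationary (P.finiteKernel (box d L) fun _ => ⊤) νmax)
    (hmin : IsStationary (P.finiteKernel (box d L) fun _ => ⊥) νmin) :
    (∫ σ, v (σ ⟨0, zero_mem_box d L⟩) ∂νmax) - (∫ σ, v (σ ⟨0, zero_mem_box d L⟩) ∂νmin)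
      ≤ gap P v n := by
  have := hmax.1
  have := hmin.1
  have hm := monotone_eval (zero_mem_box d L) hv
  have hpatch : ∀ s : S, patch (box d L) (fun _ => s) (fun _ => s) = fun _ => s := fun s =>
    funext fun k => by simp [patch]
  rw [← hmax.integral_iterate (BddMeas.of_finite _) n,
    ← hmin.integral_iterate (BddMeas.of_finite _) n]
  refine sub_le_sub ?_ ?_
  · have e := iterate_avg_eq_finite hr v (fun _ => ⊤) hn (fun _ => ⊤)
    rw [hpatch] at e
    rw [← e]
    exact integral_le_of_forall_le (BddMeas.of_finite _) fun x =>
      monotone_iterate_avg_finite ha _ hm n fun _ => le_top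
  · have e := iterate_avg_eq_finite hr v (fun _ => ⊥) hn (fun _ => ⊥)
    rw [hpatch] at e
    rw [← e]
    exact le_integral_of_forall_le (BddMeas.of_finite _) fun x =>
      monotone_iterate_avg_finite ha _ hm n fun _ => bot_le

end FiniteRange

end PCA

/-! ### The equivalence. -/

theorem theorem1 (d : ℕ) {S : Type*} [Fintype S] [LinearOrder S] [BoundedOrder S]
    [MeasurableSpace S] [DiscreteMeasurableSpace S]
    -- the numerical value of a spin
    (v : S → ℝ) (hv : StrictMono v)
    (P : PCA.Automaton d S)
    (hattr : P.Attractive) (htrans : P.TranslationInvariant)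
    (hnondeg : P.NonDegenerate) (hlocal : P.Local)
    -- the stationary measures in the boxes, with maximal and minimal boundary condition
    (νmax νmin : ∀ L : ℕ, MeasureTheory.Measure (PCA.box d L → S))
    (hmax : ∀ L, PCA.IsStationary (P.finiteKernel (PCA.box d L) (fun _ => ⊤)) (νmax L))
    (hmin : ∀ L, PCA.IsStationary (P.finiteKernel (PCA.box d L) (fun _ => ⊥)) (νmin L)) :
    (∃ C : ℝ, 0 < C ∧ ∃ M : ℝ, 0 < M ∧ ∃ L₁ : ℕ, 1 ≤ L₁ ∧ ∀ L : ℕ, L₁ ≤ L →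
      (∫ σ, v (σ ⟨0, PCA.zero_mem_box d L⟩) ∂(νmax L))
        - (∫ σ, v (σ ⟨0, PCA.zero_mem_box d L⟩) ∂(νmin L)) ≤ C * Real.exp (-(M * L)))
    ↔
    (∃ ν : MeasureTheory.Measure (PCA.Config d S),
      (PCA.IsStationary P.kernel ν ∧ ∀ ν', PCA.IsStationary P.kernel ν' → ν' = ν) ∧
      ∃ lam : ℝ, 0 < lam ∧ ∃ n₁ : ℕ, ∀ n : ℕ, n₁ ≤ n →
        ∀ f : PCA.Config d S → ℝ, PCA.IsLocal f →
          ∀ σ : PCA.Config d S,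
            |(∫ ω, f ω ∂(PCA.evolve P.kernel (MeasureTheory.Measure.dirac σ) n)) - ∫ ω, f ω ∂ν|
              ≤ 2 * PCA.tripleNorm f * Real.exp (-(lam * n))) := by
  have hvm := hv.monotone
  constructor
  · rintro ⟨C, hC, M, hM, L₁, -, h⟩
    obtain ⟨δ, hδ, hvδ⟩ := PCA.exists_pos_le_sub hv
    obtain ⟨hlim, lam, hlam, hdecay⟩ :=
      PCA.exp_decay_gap hattr htrans hnondeg hvm hδ hvδ hmax hmin hC hM h
    obtain ⟨ν, hν, huniq⟩ := PCA.exists_unique_stationary hattr htrans hlocal hvm hδ hvδ hlim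
    have := hν.1
    have hlam2 : 0 < lam / 2 := by positivity
    have t : Filter.Tendsto (fun n : ℕ => Real.exp (-(lam / 2 * n))) Filter.atTop (nhds 0) :=
      Real.tendsto_exp_neg_atTop_nhds_zero.comp
        ((tendsto_natCast_atTop_atTop (R := ℝ)).const_mul_atTop hlam2)
    -- Half of the decay rate is spent on absorbing the factor 1/δ, so that the constant is exactly
    -- 2.
    obtain ⟨n₁, hn₁⟩ := (hdecay.and (t.eventually (ge_mem_nhds hδ))).exists_forall_of_atTop
    refine ⟨ν, ⟨hν, huniq⟩, lam / 2, hlam2, n₁, fun n hn f hf σ => ?_⟩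
    rw [PCA.integral_evolve_dirac P.kernel hf.bddMeas, ← hν.integral_iterate hf.bddMeas n]
    refine (PCA.abs_iterate_sub_integral_le hattr htrans hvm hδ hvδ hf n σ ν).trans
      (mul_le_mul_of_nonneg_left ?_ (mul_nonneg two_pos.le (PCA.tripleNorm_nonneg f)))
    obtain ⟨h1, h2⟩ := hn₁ n hn
    rw [div_le_iff₀ hδ]
    calc PCA.gap P v n ≤ Real.exp (-(lam * n)) := h1
      _ = Real.exp (-(lam / 2 * n)) * Real.exp (-(lam / 2 * n)) := by
        rw [← Real.exp_add]; congr 1; ring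
      _ ≤ Real.exp (-(lam / 2 * n)) * δ := mul_le_mul_of_nonneg_left h2 (Real.exp_pos _).le
  · rintro ⟨ν, -, lam, hlam, n₁, h⟩
    obtain ⟨r, hr0, hr⟩ := PCA.exists_hasRange htrans hlocal
    have hr0' : (0 : ℝ) < r := by exact_mod_cast hr0
    set T := PCA.tripleNorm (PCA.spin v 0 : PCA.Config d S → ℝ) with hT
    have hT0 : 0 ≤ T := PCA.tripleNorm_nonneg _
    have hloc : PCA.IsLocal (PCA.spin v 0 : PCA.Config d S → ℝ) :=
      ⟨{0}, fun σ η h => PCA.dependsOn_spin v 0 h⟩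
    -- The factor `exp lam` compensates the rounding in `L / r`; `+ 1` keeps the constant positive
    -- when `T = 0`.
    refine ⟨4 * T * Real.exp lam + 1, by positivity, lam / r, by positivity, r * n₁ + 1,
      Nat.succ_le_succ (Nat.zero_le _), fun L hL => ?_⟩
    set n := L / r with hn
    have hn1 : n₁ ≤ n := (Nat.le_div_iff_mul_le hr0).2 (by linarith [mul_comm n₁ r])
    have hn2 : r * n ≤ L := Nat.mul_div_le L r
    have hn3 : (L : ℝ) ≤ r * (n + 1) := by
      exact_mod_cast (Nat.lt_mul_div_succ L hr0).le
    refine (PCA.integral_sub_integral_le_gap hr hattr hvm hn2 (hmax L) (hmin L)).trans ?_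
    have htop := h n hn1 _ hloc fun _ => ⊤
    have hbot := h n hn1 _ hloc fun _ => ⊥
    rw [PCA.integral_evolve_dirac P.kernel hloc.bddMeas] at htop hbot
    have hgap : PCA.gap P v n ≤ 4 * T * Real.exp (-(lam * n)) := by
      rw [PCA.gap]
      linarith [(abs_le.1 htop).2, (abs_le.1 hbot).1]
    refine hgap.trans ?_
    have hexp : Real.exp (-(lam * n)) ≤ Real.exp lam * Real.exp (-(lam / r * L)) := by
      rw [← Real.exp_add]
      refine Real.exp_le_exp.2 ?_
      have : lam / r * L ≤ lam * (n + 1) := by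
        rw [div_mul_eq_mul_div, div_le_iff₀ hr0']
        calc lam * L ≤ lam * (r * (n + 1)) := mul_le_mul_of_nonneg_left hn3 hlam.le
          _ = lam * (n + 1) * r := by ring
      linarith
    calc 4 * T * Real.exp (-(lam * n))
        ≤ 4 * T * (Real.exp lam * Real.exp (-(lam / r * L))) :=
          mul_le_mul_of_nonneg_left hexp (by positivity)
      _ ≤ (4 * T * Real.exp lam + 1) * Real.exp (-(lam / r * L)) := by
          linarith [Real.exp_pos (-(lam / r * L))]
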